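/- Let $G$ be a finite simple graph, let $\mathbb K$ be any field and $r\ge 2$. Let $R=\mathbb K[x : x\in V(G)]$ be the standard graded polynomial ring and let $$I_r(G)=\Big(\prod_{x\in S}x \;:\; S\subseteq V(G),\ |S|=r+1,\ G[S]\text{ connected}\Big)\subseteq R$$ be the $r$-connected ideal of $G$. Suppose that $G$ belongs to one of the following classes: 1. $G$ is co-chordal-cactus, that is, its complement $\overline G$ is obtained by gluing chordal graphs and cycles along a cactus skeleton: there are a finite cactus graph $T$ (a graph in which every edge lies in at most one cycle) and induced subgraphs $H_e$ $(e\in E(T))$ of $\overline G$, each of them a chordal graph or a cycle of length at least $3$, such that $V(\overline G)=\bigcup_e V(H_e)$ and $E(\overline G)=\bigcup_e E(H_e)$; for distinct $e,f\in E(T)$ one has $|V(H_e)\cap V(H_f)|\le 1$, and the intersection is nonempty only if $e$ and $f$ share an endpoint in $T$; and the gluing is cyclic only around cycles of $T$: whenever $e_1,\dots,e_k\in E(T)$ $(k\ge 3)$ are distinct and $x_1,\dots,x_k$ are distinct vertices with $x_i\in V(H_{e_i})\cap V(H_{e_{i+1}})$ for all $i$ modulo $k$, the edges $e_1,\dots,e_k$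 lie on a common cycle of $T$; 2. $G$ is $(2K_2,C_4)$-free, that is, $G$ has no induced subgraph isomorphic to $2K_2$ or to $C_4$; 3. $G$ is isomorphic to the complement of a grid graph $P_n\square P_m$. Then $I_r(G)$ has an $(r+1)$-linear resolution: the graded Betti numbers of its minimal graded free resolution satisfy $\beta_{i,j}(I_r(G))=0$ whenever $j\ne i+r+1$. In particular, if $I_r(G)\neq 0$, then $$\operatorname{reg} I_r(G)=\max\{\,j-i : \beta_{i,j}(I_r(G))\neq 0\,\}=r+1 .$$ -/

import Mathlib

/-! ### Minimal graded free resolutions, linear resolutions, regularity -/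

section Resolutions

variable {K : Type*} [Field K] {V : Type*}

/-- A minimal graded free resolution
`0 → F_p → ⋯ → F_1 → F_0 → I → 0`, `F_i = ⨁_k R(-deg i k)`, of an ideal `I` of the standard graded
polynomial ring `R = K[x_v : v ∈ V]`. -/
structure MinimalGradedFreeResolution (I : Ideal (MvPolynomial V K)) where
  /-- the rank of `F_i` -/
  rank : ℕ → ℕ
  /-- the degree of the `k`-th basis element of `F_i` -/
  deg : ∀ i, Fin (rank i) → ℕ
  /-- the augmentation `F_0 → I ⊆ R` -/
  ε : (Fin (rank 0) → MvPolynomial V K) →ₗ[MvPolynomial V K] MvPolynomial V K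
  /-- the differential `F_{i+1} → F_i` -/
  d : ∀ i, (Fin (rank (i + 1)) → MvPolynomial V K) →ₗ[MvPolynomial V K]
    (Fin (rank i) → MvPolynomial V K)
  /-- `F_0` maps onto `I` -/
  range_ε : LinearMap.range ε = I
  exact_zero : Function.Exact (d 0) ε
  exact_succ : ∀ i, Function.Exact (d (i + 1)) (d i)
  /-- the resolution has finite length -/
  finite_length : ∃ p, ∀ i, p < i → rank i = 0
  /-- the augmentation is homogeneous of degree `0` -/
  ε_homogeneous : ∀ l, (ε (Pi.single l 1)).IsHomogeneous (deg 0 l)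
  /-- the differentials are homogeneous of degree `0`: the matrix entry in row `k` and column `l`
  is zero or homogeneous of degree `deg (i + 1) l - deg i k` -/
  d_homogeneous : ∀ i l k, d i (Pi.single l 1) k = 0 ∨
    ∃ n, n + deg i k = deg (i + 1) l ∧ (d i (Pi.single l 1) k).IsHomogeneous n
  /-- minimality: all matrix entries lie in the maximal ideal generated by the variables -/
  minimal : ∀ i l k, MvPolynomial.constantCoeff (d i (Pi.single l 1) k) = 0

/-- The graded Betti number `β_{i,j}`: the number of copies of `R(-j)` in `F_i`. -/
def MinimalGradedFreeResolution.betti {I : Ideal (MvPolynomial V K)}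
    (F : MinimalGradedFreeResolution I) (i j : ℕ) : ℕ :=
  (Finset.univ.filter fun k => F.deg i k = j).card

/-- `I` has a `d`-linear resolution: in its minimal graded free resolution (which is unique up to
isomorphism), `β_{i,j} = 0` whenever `j ≠ i + d`. -/
def HasLinearResolution (I : Ideal (MvPolynomial V K)) (d : ℕ) : Prop :=
  ∃ F : MinimalGradedFreeResolution I, ∀ i j, j ≠ i + d → F.betti i j = 0

/-- `reg I = m`: the maximum of `j - i` over all `β_{i,j} ≠ 0` in the minimal graded free
resolution (which is unique up to isomorphism) exists and equals `m`. -/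
def HasRegularity (I : Ideal (MvPolynomial V K)) (m : ℤ) : Prop :=
  ∃ F : MinimalGradedFreeResolution I,
    IsGreatest {s : ℤ | ∃ i j : ℕ, F.betti i j ≠ 0 ∧ s = (j : ℤ) - (i : ℤ)} m

end Resolutions

/-! ### Connected ideals -/

/-- The `r`-connected ideal `I_r(G)`, generated by the squarefree monomials `∏_{x ∈ S} x` with
`|S| = r + 1` and `G[S]` connected. -/
noncomputable def connectedIdeal (K : Type*) [Field K] {V : Type*} (G : SimpleGraph V) (r : ℕ) :
    Ideal (MvPolynomial V K) :=
  Ideal.span {p | ∃ S : Finset V, S.card = r + 1 ∧ (G.induce (S : Set V)).Connected ∧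
    p = ∏ x ∈ S, MvPolynomial.X x}

/-! ### Graph classes -/

namespace SimpleGraph

/-- Every induced cycle has length three. -/
def IsChordalGraph {V : Type*} (H : SimpleGraph V) : Prop :=
  ∀ n, 4 ≤ n → ¬ (cycleGraph n).IsIndContained H

/-- The whole graph is a cycle of length at least three. -/
def IsCycleOfLengthGeThree {V : Type*} (H : SimpleGraph V) : Prop :=
  ∃ n, 3 ≤ n ∧ Nonempty (H ≃g cycleGraph n)

/-- Every edge lies in at most one cycle (cycles that share an edge have the same edges). -/
def IsCactus {W : Type*} (T : SimpleGraph W) : Prop :=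
  ∀ ⦃u v : W⦄ (p : T.Walk u u) (q : T.Walk v v), p.IsCycle → q.IsCycle →
    (∃ e, e ∈ p.edges ∧ e ∈ q.edges) → ∀ f, f ∈ p.edges ↔ f ∈ q.edges

/-- The graph `H` is obtained by gluing the induced subgraphs `H_e = H[P e]`, `e ∈ E(T)`, along
the cactus `T`. -/
structure IsChordalCactusDecomposition {V W : Type*} (H : SimpleGraph V) (T : SimpleGraph W)
    (P : T.edgeSet → Set V) : Prop where
  cactus : T.IsCactus
  chordal_or_cycle : ∀ e, (H.induce (P e)).IsChordalGraph ∨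
    (H.induce (P e)).IsCycleOfLengthGeThree
  cover_vertices : ∀ x, ∃ e, x ∈ P e
  cover_edges : ∀ x y, H.Adj x y → ∃ e, x ∈ P e ∧ y ∈ P e
  inter_subsingleton : ∀ e f, e ≠ f → (P e ∩ P f).Subsingleton
  inter_common_endpoint : ∀ e f, e ≠ f → (P e ∩ P f).Nonempty →
    ∃ w : W, w ∈ (e : Sym2 W) ∧ w ∈ (f : Sym2 W)
  /-- The gluing is cyclic only around cycles of the skeleton: whenever distinct pieces
  `H_{e_0}, …, H_{e_{m-1}}`, `m ≥ 3`, are glued in a ring at distinct vertices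
  `x_i ∈ V(H_{e_i}) ∩ V(H_{e_{i+1}})` (indices modulo `m`), the `e_i` lie on a cycle of `T`. -/
  ring_on_cycle : ∀ (m : ℕ) (e : Fin (m + 3) → T.edgeSet) (x : Fin (m + 3) → V),
    Function.Injective e → Function.Injective x →
    (∀ i, x i ∈ P (e i) ∩ P (e (i + 1))) →
    ∃ (u : W) (c : T.Walk u u), c.IsCycle ∧ ∀ i, (e i : Sym2 W) ∈ c.edges

/-- The complement of `G` has a decomposition along a (finite) cactus into chordal graphs and
cycles. -/
def IsCoChordalCactus {V : Type*} (G : SimpleGraph V) : Prop :=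
  ∃ (n : ℕ) (T : SimpleGraph (Fin n)) (P : T.edgeSet → Set V),
    IsChordalCactusDecomposition Gᶜ T P

/-- No induced subgraph is isomorphic to `2K_2` or to `C_4`. -/
def IsTwoKTwoCFourFree {V : Type*} (G : SimpleGraph V) : Prop :=
  ¬ ((completeGraph (Fin 2)).sum (completeGraph (Fin 2))).IsIndContained G ∧
    ¬ (cycleGraph 4).IsIndContained G

/-- `G` is the complement of a grid graph `P_n □ P_m`. -/
def IsCoGrid {V : Type*} (G : SimpleGraph V) : Prop :=
  ∃ n m : ℕ, Nonempty (G ≃g ((pathGraph n).boxProd (pathGraph m))ᶜ)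

end SimpleGraph

/-! Write `H` for the complement of `G`. Generators of equal degree give a linear resolution once
they can be ordered with linear quotients: each colon ideal (earlier generators) : (next generator)
is generated by variables. `LinearlyResolved.sup_span_singleton` then builds the resolution one
generator at a time by a horseshoe argument, over any field. For squarefree monomials the condition
becomes the exchange property recorded in `LinQuot`.

`LinQuot.connectedFamily_succ` carries linear quotients from connected `n`-sets to connected `(n +
1)`-sets, so everything reduces to triples. (Pairs cannot serve as the base: the complement of a
four-cycle is `2K_2`, whose edge ideal has no linear resolution.) A triple is connected in `G`
exactly when one of its vertices is isolated in `H` on that triple, whence `isolatedTriples`.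

Two moves reduce the triples inside a vertex set `W`. `linQuot_isolatedTriples_of_erase` deletes a
vertex whose neighbourhood in `H[W]` is a clique minus a matching; `linQuot_isolatedTriples_of_edge`
undoes the addition of an edge under local conditions. In a grid a vertex of least coordinate sum
can always be deleted, in the `(2K_2, C_4)`-free case a vertex of least degree in `H[W]`.

For a chordal cactus, suppose that no vertex can be deleted. In an end block of the incidence graph
of pieces and shared vertices, the cactus condition leaves every piece at most two shared vertices
and every shared vertex at most two pieces. A chordal piece with two shared vertices shrinks to
these two (`linQuot_isolatedTriples_of_attached`, by simplicial vertices and added edges), and a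
cycle has no unshared vertex left. If nothing shrinks, some shared vertex has at most two neighbours
and can be deleted after all. -/

/-! ### Linear resolutions built from successive kernels -/

section LinearKernels

open MvPolynomial

variable {K : Type*} [Field K] {V : Type*}

/-- A linear map of free modules over the polynomial ring that raises degrees by `e`. -/
def IsHomogeneousMap {α β : Type*}
    (f : (β → MvPolynomial V K) →ₗ[MvPolynomial V K] (α → MvPolynomial V K)) (e : ℕ) : Prop :=
  ∀ n u, (∀ l, (u l : MvPolynomial V K).IsHomogeneous n) → ∀ k, (f u k).IsHomogeneous (n + e)

theorem IsHomogeneousMap.map_homogeneousComponent {α β : Type*} [Fintype β]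
    {f : (β → MvPolynomial V K) →ₗ[MvPolynomial V K] (α → MvPolynomial V K)} {e : ℕ}
    (hf : IsHomogeneousMap f e) (n : ℕ) (u : β → MvPolynomial V K) (k : α) :
    homogeneousComponent (n + e) (f u k) = f (fun l => homogeneousComponent n (u l)) k := by
  classical
  set N := Finset.univ.sup fun l => (u l).totalDegree with hN
  -- The bound exceeds both `n` and every total degree, so the sum contains all nonzero components
  -- and also the summand `n` singled out below.
  have hu : u = ∑ i ∈ Finset.range (N + n + 1), fun l => homogeneousComponent i (u l) := by
    funext l
    rw [Finset.sum_apply]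
    conv_lhs => rw [← sum_homogeneousComponent (u l)]
    refine Finset.sum_subset ?_ ?_
    · intro i hi
      have : (u l).totalDegree ≤ N := Finset.le_sup (f := fun l => (u l).totalDegree)
        (Finset.mem_univ l)
      simp only [Finset.mem_range] at hi ⊢
      omega
    · intro i _ hi
      refine homogeneousComponent_eq_zero _ _ ?_
      simp only [Finset.mem_range] at hi
      omega
  conv_lhs => rw [hu]
  rw [map_sum, Finset.sum_apply, map_sum, Finset.sum_eq_single n]
  · exact homogeneousComponent_eq_self
      (hf n _ (fun l => homogeneousComponent_isHomogeneous n (u l)) k)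
  · intro i _ hi
    rw [homogeneousComponent_of_mem
      (hf i _ (fun l => homogeneousComponent_isHomogeneous i (u l)) k), if_neg (by omega)]
  · intro h
    simp at h

/-- Any preimage may be replaced by its component of degree `n`. This keeps the lifts in the
horseshoe argument linear. -/
theorem IsHomogeneousMap.exists_homogeneous_preimage {α β : Type*} [Fintype β]
    {f : (β → MvPolynomial V K) →ₗ[MvPolynomial V K] (α → MvPolynomial V K)} {e n : ℕ}
    (hf : IsHomogeneousMap f e) {w : α → MvPolynomial V K}
    (hw : ∀ k, (w k).IsHomogeneous (n + e)) (hmem : w ∈ LinearMap.range f) :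
    ∃ u, (∀ l, (u l : MvPolynomial V K).IsHomogeneous n) ∧ f u = w := by
  obtain ⟨u, rfl⟩ := hmem
  refine ⟨fun l => homogeneousComponent n (u l), fun l => homogeneousComponent_isHomogeneous n _, ?_⟩
  funext k
  rw [← hf.map_homogeneousComponent, homogeneousComponent_eq_self (hw k)]

/-- `LinearlyResolved α N d`: the submodule `N` of a free module has a finite free resolution whose
generators have entries of degree `d` and whose higher syzygies are linear. -/
inductive LinearlyResolved : ∀ (α : Type), Submodule (MvPolynomial V K) (α → MvPolynomial V K) →
    ℕ → Prop
  | bot (α : Type) (d : ℕ) : LinearlyResolved α ⊥ d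
  | range {α β : Type} [Fintype β]
      (f : (β → MvPolynomial V K) →ₗ[MvPolynomial V K] (α → MvPolynomial V K)) {d : ℕ}
      (hf : IsHomogeneousMap f d) (h : LinearlyResolved β (LinearMap.ker f) 1) :
      LinearlyResolved α (LinearMap.range f) d

/-- The zero submodule is the range of a map from the module of rank zero, so both constructors can
be handled alike. -/
theorem LinearlyResolved.exists_range {α : Type}
    {N : Submodule (MvPolynomial V K) (α → MvPolynomial V K)} {d : ℕ}
    (h : LinearlyResolved α N d) :
    ∃ (β : Type) (_ : Fintype β)
      (f : (β → MvPolynomial V K) →ₗ[MvPolynomial V K] (α → MvPolynomial V K)),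
      IsHomogeneousMap f d ∧ LinearlyResolved β (LinearMap.ker f) 1 ∧ LinearMap.range f = N := by
  cases h with
  | bot =>
    refine ⟨Empty, inferInstance, 0, fun n u _ k => isHomogeneous_zero _ _ _, ?_, by simp⟩
    have : LinearMap.ker (0 : (Empty → MvPolynomial V K) →ₗ[MvPolynomial V K]
        (α → MvPolynomial V K)) = ⊥ := Subsingleton.elim _ _
    rw [this]
    exact .bot _ _
  | range f hf h => exact ⟨_, inferInstance, f, hf, h, rfl⟩

/-- The horseshoe lemma for linearly resolved submodules. -/
theorem LinearlyResolved.horseshoe {α β : Type}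
    {N'' : Submodule (MvPolynomial V K) (β → MvPolynomial V K)} {d : ℕ}
    (h'' : LinearlyResolved β N'' d)
    {N' : Submodule (MvPolynomial V K) (α → MvPolynomial V K)} (h' : LinearlyResolved α N' d)
    {N : Submodule (MvPolynomial V K) (α ⊕ β → MvPolynomial V K)}
    (h₁ : ∀ x ∈ N, x ∘ Sum.inr ∈ N'') (h₂ : ∀ u : α → MvPolynomial V K, Sum.elim u (0 : β → MvPolynomial V K) ∈ N ↔ u ∈ N')
    (h₃ : ∀ v ∈ N'', (∀ j, (v j).IsHomogeneous d) →
      ∃ u, (∀ i, (u i : MvPolynomial V K).IsHomogeneous d) ∧ Sum.elim u v ∈ N) :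
    LinearlyResolved (α ⊕ β) N d := by
  classical
  induction h'' generalizing α with
  | bot β d =>
    obtain ⟨γ, _, g, hg, hker, rfl⟩ := h'.exists_range
    let i : (α → MvPolynomial V K) →ₗ[MvPolynomial V K] (α ⊕ β → MvPolynomial V K) :=
      LinearMap.pi (Sum.elim LinearMap.proj 0)
    have hi : ∀ u, i u = Sum.elim u 0 := by
      intro u; funext k; cases k <;> simp [i]
    have hN : N = LinearMap.range (i ∘ₗ g) := by
      ext x
      constructor
      · intro hx
        have h0 : x ∘ Sum.inr = 0 := by simpa using h₁ x hx
        have hx' : x = Sum.elim (x ∘ Sum.inl) 0 := by rw [← h0, Sum.elim_comp_inl_inr]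
        rw [hx'] at hx
        obtain ⟨s, hs⟩ := (h₂ _).1 hx
        exact ⟨s, by rw [LinearMap.comp_apply, hs, hi, ← hx']⟩
      · rintro ⟨s, rfl⟩
        rw [LinearMap.comp_apply, hi]
        exact (h₂ _).2 ⟨s, rfl⟩
    have hinj : LinearMap.ker i = ⊥ := by
      rw [LinearMap.ker_eq_bot]
      intro u v huv
      rw [hi, hi] at huv
      simpa using congrArg (· ∘ Sum.inl) huv
    rw [hN]
    refine .range _ ?_ ?_
    · rintro n u hu (k | k)
      · simpa [hi] using hg n u hu k
      · simpa [hi] using isHomogeneous_zero _ _ _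
    · rwa [LinearMap.ker_comp_of_ker_eq_bot _ hinj]
  | @range β γ'' _ g'' d hg'' hker'' ih =>
    obtain ⟨γ', _, g', hg', hker', rfl⟩ := h'.exists_range
    -- Only the images of the basis vectors need lifts to `N`; they have degree `d`, which is why
    -- the third hypothesis is restricted to that degree.
    have hsingle : ∀ j : γ'', ∃ u, (∀ i, (u i : MvPolynomial V K).IsHomogeneous d) ∧
        Sum.elim u (g'' (Pi.single j 1)) ∈ N := by
      intro j
      refine h₃ _ ⟨_, rfl⟩ fun k => ?_
      have := hg'' 0 (Pi.single j 1) (fun l => ?_) k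
      · simpa using this
      · by_cases hl : l = j
        · subst hl; simpa using isHomogeneous_one _ _
        · simpa [hl] using isHomogeneous_zero _ _ _
    choose u hu hmem using hsingle
    let c : (γ'' → MvPolynomial V K) →ₗ[MvPolynomial V K] (α → MvPolynomial V K) :=
      Fintype.linearCombination (MvPolynomial V K) u
    have hc : ∀ t, c t = ∑ j, t j • u j := fun t => rfl
    have hch : IsHomogeneousMap c d := by
      intro n t ht k
      rw [hc, Finset.sum_apply]
      exact IsHomogeneous.sum _ _ _ fun j _ => (ht j).mul (hu j k)
    have hcN : ∀ t, Sum.elim (c t) (g'' t) ∈ N := by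
      intro t
      have : Sum.elim (c t) (g'' t) = ∑ j, t j • Sum.elim (u j) (g'' (Pi.single j 1)) := by
        have hg : g'' t = ∑ j, t j • g'' (Pi.single j 1) := by
          conv_lhs => rw [pi_eq_sum_univ' t]
          rw [map_sum]
          exact Finset.sum_congr rfl fun j _ => map_smul _ _ _
        funext k
        cases k with
        | inl k => simp [hc, Finset.sum_apply]
        | inr k => rw [hg]; simp [Finset.sum_apply]
      rw [this]
      exact N.sum_mem fun j _ => N.smul_mem _ (hmem j)
    let g : (γ' ⊕ γ'' → MvPolynomial V K) →ₗ[MvPolynomial V K] (α ⊕ β → MvPolynomial V K) :=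
      LinearMap.pi (Sum.elim
        (fun k => LinearMap.proj k ∘ₗ (g' ∘ₗ LinearMap.funLeft _ _ Sum.inl +
          c ∘ₗ LinearMap.funLeft _ _ Sum.inr))
        (fun k => LinearMap.proj k ∘ₗ g'' ∘ₗ LinearMap.funLeft _ _ Sum.inr))
    have hg : ∀ x, g x = Sum.elim (g' (x ∘ Sum.inl) + c (x ∘ Sum.inr)) (g'' (x ∘ Sum.inr)) := by
      intro x; funext k; cases k <;> rfl
    have hsplit : ∀ a b v, (Sum.elim (a + b) v : α ⊕ β → MvPolynomial V K) =
        Sum.elim a 0 + Sum.elim b v := by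
      intro a b v; funext k; cases k <;> simp
    have hN : N = LinearMap.range g := by
      ext x
      constructor
      · intro hx
        obtain ⟨t, ht⟩ := h₁ x hx
        have hx' : x = Sum.elim (x ∘ Sum.inl - c t) 0 + Sum.elim (c t) (g'' t) := by
          rw [← hsplit, ht, sub_add_cancel, Sum.elim_comp_inl_inr]
        have : Sum.elim (x ∘ Sum.inl - c t) 0 ∈ N := by
          have := N.sub_mem hx (hcN t)
          rwa [hx', add_sub_cancel_right] at this
        obtain ⟨s, hs⟩ := (h₂ _).1 this
        refine ⟨Sum.elim s t, ?_⟩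
        rw [hg, Sum.elim_comp_inl, Sum.elim_comp_inr, hs, hsplit, ← hx']
      · rintro ⟨x, rfl⟩
        rw [hg, hsplit]
        exact N.add_mem ((h₂ _).2 ⟨_, rfl⟩) (hcN _)
    rw [hN]
    refine .range g ?_ ?_
    · rintro n x hx (k | k)
      · rw [hg]
        exact (hg' n _ (fun l => hx (Sum.inl l)) k).add (hch n _ (fun l => hx (Sum.inr l)) k)
      · rw [hg]
        exact hg'' n _ (fun l => hx (Sum.inr l)) k
    -- The kernel of `g` again sits between the kernels of `g'` and `g''`, now with `d = 1`. A
    -- linear syzygy `t` of `g''` lifts because `c t` lies in the range of `g'` and has a linear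
    -- preimage.
    · refine ih hker' ?_ ?_ ?_
      · intro x hx
        rw [LinearMap.mem_ker, hg] at hx
        simpa using congrArg (· ∘ Sum.inr) hx
      · intro s
        rw [LinearMap.mem_ker, hg, LinearMap.mem_ker]
        simp only [Sum.elim_comp_inl, Sum.elim_comp_inr, map_zero, add_zero]
        constructor
        · intro h; simpa using congrArg (· ∘ Sum.inl) h
        · intro h; rw [h]; funext k; cases k <;> rfl
      · intro t ht hth
        have hw : Sum.elim (c t) 0 ∈ N := by
          have := hcN t
          rwa [LinearMap.mem_ker.1 ht] at this
        obtain ⟨s, hs, hst⟩ := hg'.exists_homogeneous_preimage (n := 1) (w := - c t)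
          (fun k => (hch 1 t hth k).neg) (neg_mem ((h₂ _).1 hw))
        refine ⟨s, hs, ?_⟩
        rw [LinearMap.mem_ker, hg, Sum.elim_comp_inl, Sum.elim_comp_inr, hst,
          LinearMap.mem_ker.1 ht, neg_add_cancel]
        funext k; cases k <;> rfl

/-- An ideal, as a submodule of the free module of rank one. -/
noncomputable def Ideal.toUnit (I : Ideal (MvPolynomial V K)) :
    Submodule (MvPolynomial V K) (Unit → MvPolynomial V K) :=
  Submodule.comap (LinearMap.proj ()) I

theorem Ideal.mem_toUnit {I : Ideal (MvPolynomial V K)} {v : Unit → MvPolynomial V K} :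
    v ∈ I.toUnit ↔ v () ∈ I := Iff.rfl

/-- With `J` presented by `f`, a syzygy of `J` together with `m` has as its last coordinate an
element of the colon ideal `C = J : m`, and the syzygies with last coordinate zero are those of `f`.
So the syzygy module is an extension to which the horseshoe lemma applies. -/
theorem LinearlyResolved.sup_span_singleton {J : Ideal (MvPolynomial V K)} {m : MvPolynomial V K}
    {d : ℕ} (hJ : LinearlyResolved Unit J.toUnit d) (hm : m.IsHomogeneous d)
    {C : Ideal (MvPolynomial V K)} (hC : LinearlyResolved Unit C.toUnit 1)
    (hcolon : ∀ p, p ∈ C ↔ p * m ∈ J) :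
    LinearlyResolved Unit (J ⊔ Ideal.span {m}).toUnit d := by
  classical
  obtain ⟨β, _, f, hf, hker, hrange⟩ := hJ.exists_range
  let g : (β ⊕ Unit → MvPolynomial V K) →ₗ[MvPolynomial V K] (Unit → MvPolynomial V K) :=
    f ∘ₗ LinearMap.funLeft _ _ Sum.inl +
      LinearMap.pi (fun _ => LinearMap.mulRight (MvPolynomial V K) m ∘ₗ LinearMap.proj (Sum.inr ()))
  have hg : ∀ x k, g x k = f (x ∘ Sum.inl) () + x (Sum.inr ()) * m := fun x k => rfl
  have hJf : ∀ u, f u () ∈ J := fun u => by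
    have : f u ∈ J.toUnit := hrange ▸ ⟨u, rfl⟩
    exact this
  have hrg : (J ⊔ Ideal.span {m}).toUnit = LinearMap.range g := by
    ext v
    rw [Ideal.mem_toUnit]
    constructor
    · intro hv
      obtain ⟨a, ha, b, hb, hab⟩ := Submodule.mem_sup.1 hv
      obtain ⟨c, rfl⟩ := Ideal.mem_span_singleton'.1 hb
      have : (fun _ => a : Unit → MvPolynomial V K) ∈ LinearMap.range f := by
        rw [hrange]; exact ha
      obtain ⟨u, hu⟩ := this
      refine ⟨Sum.elim u fun _ => c, ?_⟩
      funext k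
      rw [hg, Sum.elim_comp_inl, hu]
      exact hab
    · rintro ⟨x, rfl⟩
      rw [hg]
      exact Submodule.add_mem_sup (hJf _) (Ideal.mem_span_singleton'.2 ⟨_, rfl⟩)
  rw [hrg]
  refine .range g ?_ (hC.horseshoe hker ?_ ?_ ?_)
  · intro n x hx k
    rw [hg]
    exact (hf n _ (fun l => hx (Sum.inl l)) ()).add ((hx (Sum.inr ())).mul hm)
  · intro x hx
    rw [Ideal.mem_toUnit, hcolon]
    have h0 : g x () = 0 := by rw [LinearMap.mem_ker.1 hx]; rfl
    rw [hg] at h0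
    have : (x ∘ Sum.inr) () * m = - f (x ∘ Sum.inl) () := by
      rw [eq_neg_iff_add_eq_zero, add_comm]; exact h0
    rw [this]
    exact neg_mem (hJf _)
  · intro u
    rw [LinearMap.mem_ker, LinearMap.mem_ker]
    constructor
    · intro h; funext k; have := congrFun h k; rw [hg] at this; simpa using this
    · intro h; funext k; rw [hg]; simp [h]
  · intro v hv hvh
    have hmem : (fun _ => - (v () * m) : Unit → MvPolynomial V K) ∈ LinearMap.range f := by
      rw [hrange, Ideal.mem_toUnit]
      exact neg_mem ((hcolon _).1 hv)
    obtain ⟨u, hu, huv⟩ := hf.exists_homogeneous_preimage (n := 1)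
      (fun k => ((hvh ()).mul hm).neg) hmem
    refine ⟨u, hu, ?_⟩
    rw [LinearMap.mem_ker]
    funext k
    rw [hg, Sum.elim_comp_inl, huv]
    simp

/-- Unrolls successive kernels into a chain of maps between coordinate modules. -/
theorem LinearlyResolved.exists_chain {α : Type}
    {N : Submodule (MvPolynomial V K) (α → MvPolynomial V K)} {d : ℕ}
    (h : LinearlyResolved α N d) :
    ∃ (rank : ℕ → ℕ)
      (ε : (Fin (rank 0) → MvPolynomial V K) →ₗ[MvPolynomial V K] (α → MvPolynomial V K))
      (D : ∀ i, (Fin (rank (i + 1)) → MvPolynomial V K) →ₗ[MvPolynomial V K]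
        (Fin (rank i) → MvPolynomial V K)),
      LinearMap.range ε = N ∧ Function.Exact (D 0) ε ∧
      (∀ i, Function.Exact (D (i + 1)) (D i)) ∧ (∃ p, ∀ i, p < i → rank i = 0) ∧
      IsHomogeneousMap ε d ∧ ∀ i, IsHomogeneousMap (D i) 1 := by
  induction h with
  | bot α d =>
    refine ⟨fun _ => 0, 0, fun _ => 0, by simp, ?_, ?_, ⟨0, fun _ _ => rfl⟩,
      fun n u _ k => isHomogeneous_zero _ _ _, fun i n u _ k => isHomogeneous_zero _ _ _⟩
    · intro y; exact ⟨fun _ => ⟨0, Subsingleton.elim _ _⟩, fun _ => rfl⟩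
    · intro i y; exact ⟨fun _ => ⟨0, Subsingleton.elim _ _⟩, fun _ => rfl⟩
  | @range α β _ f d hf h ih =>
    obtain ⟨rank, ε, D, hε, h0, hs, ⟨p, hp⟩, hεh, hDh⟩ := ih
    let e : β ≃ Fin (Fintype.card β) := Fintype.equivFin β
    let c := LinearEquiv.funCongrLeft (MvPolynomial V K) (MvPolynomial V K) e
    let rank' : ℕ → ℕ := fun i => Nat.casesOn i (Fintype.card β) rank
    let D' : ∀ i, (Fin (rank' (i + 1)) → MvPolynomial V K) →ₗ[MvPolynomial V K]
        (Fin (rank' i) → MvPolynomial V K) := fun i =>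
      match i with
      | 0 => c.symm.toLinearMap ∘ₗ ε
      | i + 1 => D i
    refine ⟨rank', f ∘ₗ c.toLinearMap, D', ?_, ?_, ?_, ⟨p + 1, ?_⟩, ?_, ?_⟩
    · rw [LinearMap.range_comp_of_range_eq_top _ (LinearEquiv.range c)]
    · intro y
      have hy : f (c y) = 0 ↔ c y ∈ LinearMap.range ε := by rw [hε, LinearMap.mem_ker]
      refine hy.trans ⟨?_, ?_⟩
      · rintro ⟨x, hx⟩
        refine ⟨x, ?_⟩
        change c.symm (ε x) = y
        rw [hx, LinearEquiv.symm_apply_apply]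
      · rintro ⟨x, hx⟩
        refine ⟨x, ?_⟩
        change c.symm (ε x) = y at hx
        rw [← hx, LinearEquiv.apply_symm_apply]
    · rintro (_ | i)
      · intro y
        change c.symm (ε y) = 0 ↔ _
        rw [LinearEquiv.map_eq_zero_iff]
        exact h0 y
      · exact hs i
    · rintro (_ | i) hi
      · omega
      · exact hp i (by omega)
    · intro n u hu k
      exact hf n _ (fun l => hu (e l)) k
    · rintro (_ | i)
      · intro n u hu k
        exact hεh n u hu (e.symm k)
      · exact hDh i

theorem IsHomogeneousMap.single {α β : Type*} [DecidableEq β]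
    {f : (β → MvPolynomial V K) →ₗ[MvPolynomial V K] (α → MvPolynomial V K)} {e : ℕ}
    (hf : IsHomogeneousMap f e) (l : β) (k : α) : (f (Pi.single l 1) k).IsHomogeneous e := by
  have := hf 0 (Pi.single l 1) (fun l' => ?_) k
  · simpa using this
  · by_cases hl : l' = l
    · subst hl; simpa using isHomogeneous_one _ _
    · simpa [hl] using isHomogeneous_zero _ _ _

/-- Minimality is automatic: every entry of a differential is homogeneous of degree one, so it has
no constant term. -/
theorem LinearlyResolved.exists_resolution {I : Ideal (MvPolynomial V K)} {d : ℕ}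
    (h : LinearlyResolved Unit I.toUnit d) :
    ∃ F : MinimalGradedFreeResolution I, ∀ i k, F.deg i k = i + d := by
  obtain ⟨rank, ε, D, hε, h0, hs, hfin, hεh, hDh⟩ := h.exists_chain
  refine ⟨{ rank := rank, deg := fun i _ => i + d, ε := LinearMap.proj () ∘ₗ ε, d := D,
            range_ε := ?_, exact_zero := ?_, exact_succ := hs, finite_length := hfin,
            ε_homogeneous := ?_, d_homogeneous := ?_, minimal := ?_ }, fun _ _ => rfl⟩
  · rw [LinearMap.range_comp, hε]
    ext p
    constructor
    · rintro ⟨v, hv, rfl⟩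
      exact hv
    · intro hp
      exact ⟨fun _ => p, hp, rfl⟩
  · intro y
    rw [← h0 y]
    exact ⟨fun h => funext fun _ => h, fun h => congrFun h ()⟩
  · intro l
    simpa using hεh.single l ()
  · intro i l k
    exact Or.inr ⟨1, by omega, (hDh i).single l k⟩
  · intro i l k
    rw [constantCoeff_eq]
    exact ((hDh i).single l k).coeff_eq_zero (by simp)

theorem hasLinearResolution_of_linearlyResolved {I : Ideal (MvPolynomial V K)} {d : ℕ}
    (h : LinearlyResolved Unit I.toUnit d) : HasLinearResolution I d := by
  obtain ⟨F, hF⟩ := h.exists_resolution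
  refine ⟨F, fun i j hj => ?_⟩
  rw [MinimalGradedFreeResolution.betti, Finset.card_eq_zero, Finset.filter_eq_empty_iff]
  intro k _ hk
  exact hj (hk ▸ hF i k)

theorem hasRegularity_of_linearlyResolved {I : Ideal (MvPolynomial V K)} {d : ℕ}
    (h : LinearlyResolved Unit I.toUnit d) (hI : I ≠ ⊥) : HasRegularity I d := by
  obtain ⟨F, hF⟩ := h.exists_resolution
  have hbetti : ∀ i j, F.betti i j ≠ 0 → j = i + d := by
    intro i j hj
    obtain ⟨k, hk⟩ := Finset.card_ne_zero.1 hj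
    exact ((Finset.mem_filter.1 hk).2).symm.trans (hF i k)
  refine ⟨F, ⟨0, d, ?_, by simp⟩, ?_⟩
  · have hrank : F.rank 0 ≠ 0 := by
      intro h0
      apply hI
      rw [← F.range_ε, LinearMap.range_eq_bot]
      have : IsEmpty (Fin (F.rank 0)) := by rw [h0]; infer_instance
      exact LinearMap.ext fun x => by rw [Subsingleton.elim x 0, map_zero, map_zero]
    refine Finset.card_ne_zero.2 ⟨⟨0, Nat.pos_of_ne_zero hrank⟩, ?_⟩
    simpa using hF 0 _
  · rintro s ⟨i, j, hj, rfl⟩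
    rw [hbetti i j hj]
    push_cast
    omega

end LinearKernels

/-! ### Linear quotients of squarefree monomial ideals -/

section LinearQuotients

open MvPolynomial

variable {K : Type*} [Field K] {V : Type*}

theorem toUnit_bot : (⊥ : Ideal (MvPolynomial V K)).toUnit = ⊥ := by
  ext v
  rw [Ideal.mem_toUnit, Submodule.mem_bot, Submodule.mem_bot]
  exact ⟨fun h => funext fun _ => h, fun h => congrFun h ()⟩

/-- The exponent vector of a squarefree monomial. -/
noncomputable def indicatorExponent (S : Finset V) : V →₀ ℕ := ∑ x ∈ S, Finsupp.single x 1

theorem prod_X_eq_monomial (S : Finset V) :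
    ∏ x ∈ S, (X x : MvPolynomial V K) = monomial (indicatorExponent S) 1 := by
  rw [indicatorExponent, monomial_sum_one]
  rfl

variable (K) in
/-- The squarefree monomial ideal generated by a family of finite sets. -/
noncomputable def familyIdeal (F : Finset (Finset V)) : Ideal (MvPolynomial V K) :=
  Ideal.span ((fun S : Finset V => ∏ x ∈ S, X x) '' F)

theorem familyIdeal_eq_span_monomial (F : Finset (Finset V)) :
    familyIdeal K F = Ideal.span ((fun m => monomial m (1 : K)) '' (indicatorExponent '' F)) := by
  rw [familyIdeal, Set.image_image]
  simp only [prod_X_eq_monomial]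

variable [DecidableEq V]

/-- A family of finite sets that can be ordered with linear quotients. -/
inductive LinQuot : Finset (Finset V) → Prop
  | nil : LinQuot ∅
  | cons (F : Finset (Finset V)) (S : Finset V) (hF : LinQuot F)
      (h : ∀ T ∈ F, ∃ y ∈ T \ S, ∃ a ∈ S, insert y (S.erase a) ∈ F) : LinQuot (insert S F)

/-- Ideals generated by variables are linearly resolved. -/
theorem linearlyResolved_span_X (A : Finset V) :
    LinearlyResolved Unit (Ideal.span (X '' (A : Set V)) : Ideal (MvPolynomial V K)).toUnit 1 := by
  induction A using Finset.induction_on with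
  | empty =>
    rw [Finset.coe_empty, Set.image_empty, Ideal.span_empty, toUnit_bot]
    exact .bot _ _
  | insert a A ha ih =>
    have : Ideal.span (X '' ((insert a A : Finset V) : Set V)) =
        (Ideal.span (X '' (A : Set V)) ⊔ Ideal.span {X a} : Ideal (MvPolynomial V K)) := by
      rw [Finset.coe_insert, Set.image_insert_eq, Ideal.span_insert, sup_comm]
    rw [this]
    -- A variable outside `A` is a nonzerodivisor modulo the ideal of `A`, so the colon ideal is
    -- that ideal itself and `ih` serves twice.
    refine ih.sup_span_singleton (isHomogeneous_X _ _) ih fun p => ?_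
    refine ⟨fun h => Ideal.mul_mem_right _ _ h, fun h => ?_⟩
    rw [mem_ideal_span_X_image] at h ⊢
    intro m hm
    obtain ⟨i, hi, him⟩ := h (m + Finsupp.single a 1) (by
      rw [mem_support_iff, coeff_mul_X]
      exact mem_support_iff.1 hm)
    refine ⟨i, hi, ?_⟩
    have : i ≠ a := by rintro rfl; exact ha (by simpa using hi)
    simpa [this.symm] using him

theorem indicatorExponent_apply (S : Finset V) (x : V) :
    indicatorExponent S x = if x ∈ S then 1 else 0 := by
  simp [indicatorExponent, Finsupp.finsetSum_apply, Finsupp.single_apply]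

theorem mem_familyIdeal {F : Finset (Finset V)} {p : MvPolynomial V K} :
    p ∈ familyIdeal K F ↔ ∀ m ∈ p.support, ∃ S ∈ F, ∀ x ∈ S, m x ≠ 0 := by
  rw [familyIdeal_eq_span_monomial, mem_ideal_span_monomial_image]
  refine forall₂_congr fun m _ => ?_
  simp only [Set.exists_mem_image, Finset.mem_coe]
  refine exists_congr fun S => and_congr_right fun _ => ?_
  rw [Finsupp.le_def]
  refine forall_congr' fun x => ?_
  rw [indicatorExponent_apply]
  by_cases hx : x ∈ S <;> simp [hx, Nat.one_le_iff_ne_zero]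

/-- The colon ideal by the monomial of `S` is generated by the variables that can be exchanged into
`S`. If a monomial times that of `S` is divisible by that of `T`, then each `y ∈ T \ S` divides the
first factor, and the exchange property supplies such a `y` in `A`. -/
theorem mem_span_X_iff_mul_mem_familyIdeal {F : Finset (Finset V)} {S : Finset V}
    (h : ∀ T ∈ F, ∃ y ∈ T \ S, ∃ a ∈ S, insert y (S.erase a) ∈ F) {A : Finset V}
    (hA : ∀ y, y ∈ A ↔ y ∉ S ∧ ∃ a ∈ S, insert y (S.erase a) ∈ F) (p : MvPolynomial V K) :
    p ∈ Ideal.span (X '' (A : Set V)) ↔ p * ∏ x ∈ S, X x ∈ familyIdeal K F := by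
  rw [prod_X_eq_monomial, mem_familyIdeal, mem_ideal_span_X_image]
  constructor
  · intro hp m hm
    rw [mem_support_iff, coeff_mul_monomial'] at hm
    split_ifs at hm with hle
    swap
    · exact absurd rfl hm
    rw [mul_one] at hm
    obtain ⟨y, hy, hmy⟩ := hp _ (mem_support_iff.2 hm)
    obtain ⟨hyS, a, ha, hF⟩ := (hA y).1 hy
    refine ⟨_, hF, fun x hx => ?_⟩
    rcases Finset.mem_insert.1 hx with rfl | hx
    · intro h0
      rw [Finsupp.tsub_apply, h0, Nat.zero_sub] at hmy
      exact hmy rfl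
    · have := hle x
      rw [indicatorExponent_apply, if_pos (Finset.mem_of_mem_erase hx)] at this
      omega
  · intro hp m hm
    obtain ⟨T, hT, hmT⟩ := hp (m + indicatorExponent S) (by
      rw [mem_support_iff, coeff_mul_monomial, mul_one]
      exact mem_support_iff.1 hm)
    obtain ⟨y, hy, hex⟩ := h T hT
    rw [Finset.mem_sdiff] at hy
    refine ⟨y, (hA y).2 ⟨hy.2, hex⟩, ?_⟩
    have := hmT y hy.1
    rwa [Finsupp.add_apply, indicatorExponent_apply, if_neg hy.2, add_zero] at this

theorem LinQuot.linearlyResolved {F : Finset (Finset V)} (hF : LinQuot F) {d : ℕ}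
    (hd : ∀ S ∈ F, S.card = d) : LinearlyResolved Unit (familyIdeal K F).toUnit d := by
  induction hF with
  | nil =>
    rw [familyIdeal, Finset.coe_empty, Set.image_empty, Ideal.span_empty, toUnit_bot]
    exact .bot _ _
  | cons F S hF h ih =>
    have hS : familyIdeal K (insert S F) =
        familyIdeal K F ⊔ Ideal.span {∏ x ∈ S, (X x : MvPolynomial V K)} := by
      rw [familyIdeal, Finset.coe_insert, Set.image_insert_eq, Ideal.span_insert, sup_comm]
      rfl
    rw [hS]
    -- Intersecting with the union of the members of `F` only makes the set of exchangeable vertices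
    -- a `Finset`.
    have hA : ∀ y, y ∈ (F.biUnion id).filter (fun y => y ∉ S ∧ ∃ a ∈ S, insert y (S.erase a) ∈ F) ↔
        y ∉ S ∧ ∃ a ∈ S, insert y (S.erase a) ∈ F := by
      intro y
      rw [Finset.mem_filter, and_iff_right_iff_imp]
      rintro ⟨_, a, _, hF⟩
      exact Finset.mem_biUnion.2 ⟨_, hF, Finset.mem_insert_self _ _⟩
    refine (ih fun T hT => hd T (Finset.mem_insert_of_mem hT)).sup_span_singleton ?_
      (linearlyResolved_span_X _) (mem_span_X_iff_mul_mem_familyIdeal h hA)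
    rw [prod_X_eq_monomial]
    refine isHomogeneous_monomial _ ?_
    rw [indicatorExponent, map_sum]
    simp [hd S (Finset.mem_insert_self _ _)]

end LinearQuotients

/-! ### Linear quotients of connected families -/

section ConnectedFamilies

variable {V : Type*} [DecidableEq V]

/-- Distinct new members differ by a single exchange, so the order inside `N` does not matter; only
the old members need a genuine argument. -/
theorem LinQuot.union {F : Finset (Finset V)} (hF : LinQuot F) (N : Finset (Finset V))
    (h₁ : ∀ S ∈ N, S ∉ F → ∀ T ∈ F, ∃ y ∈ T \ S, ∃ a ∈ S, insert y (S.erase a) ∈ F)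
    (h₂ : ∀ S ∈ N, S ∉ F → ∀ T ∈ N, T ≠ S → ∃ y ∈ T \ S, ∃ a ∈ S, insert y (S.erase a) = T) :
    LinQuot (F ∪ N) := by
  suffices ∀ X ⊆ N, LinQuot (F ∪ X) from this N subset_rfl
  intro X
  induction X using Finset.induction_on with
  | empty => intro _; rwa [Finset.union_empty]
  | insert S X hS ih =>
    intro hX
    have hSN : S ∈ N := hX (Finset.mem_insert_self _ _)
    have hXN : X ⊆ N := (Finset.subset_insert _ _).trans hX
    rw [Finset.union_insert]
    by_cases hSF : S ∈ F
    · rw [Finset.insert_eq_of_mem (Finset.mem_union_left _ hSF)]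
      exact ih hXN
    refine .cons _ _ (ih hXN) fun T hT => ?_
    rcases Finset.mem_union.1 hT with hT | hT
    · obtain ⟨y, hy, a, ha, hya⟩ := h₁ S hSN hSF T hT
      exact ⟨y, hy, a, ha, Finset.mem_union_left _ hya⟩
    · obtain ⟨y, hy, a, ha, hya⟩ := h₂ S hSN hSF T (hXN hT) (fun h => hS (h ▸ hT))
      exact ⟨y, hy, a, ha, Finset.mem_union_right _ (hya ▸ hT)⟩

/-- A family whose members avoid `v` may be appended to a family whose members contain `v`, if
each new member can exchange an element for `v`. -/
theorem LinQuot.union_of_exchange {M N : Finset (Finset V)} (hM : LinQuot M) (hN : LinQuot N)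
    (v : V) (hv : ∀ T ∈ M, v ∈ T)
    (h : ∀ S ∈ N, v ∉ S ∧ ∃ a ∈ S, insert v (S.erase a) ∈ M) : LinQuot (M ∪ N) := by
  induction hN with
  | nil => rwa [Finset.union_empty]
  | cons N S hN hS ih =>
    rw [Finset.union_insert]
    refine .cons _ _ (ih fun S hS => h S (Finset.mem_insert_of_mem hS)) fun T hT => ?_
    rcases Finset.mem_union.1 hT with hT | hT
    · obtain ⟨hvS, a, ha, hM⟩ := h S (Finset.mem_insert_self _ _)
      exact ⟨v, Finset.mem_sdiff.2 ⟨hv T hT, hvS⟩, a, ha, Finset.mem_union_left _ hM⟩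
    · obtain ⟨y, hy, a, ha, hya⟩ := hS T hT
      exact ⟨y, hy, a, ha, Finset.mem_union_right _ hya⟩

theorem LinQuot.image_insert {F : Finset (Finset V)} (hF : LinQuot F) (v : V)
    (hv : ∀ S ∈ F, v ∉ S) : LinQuot (F.image (insert v)) := by
  induction hF with
  | nil => rw [Finset.image_empty]; exact .nil
  | cons F S hF h ih =>
    rw [Finset.image_insert]
    refine .cons _ _ (ih fun S hS => hv S (Finset.mem_insert_of_mem hS)) fun T hT => ?_
    obtain ⟨T, hTF, rfl⟩ := Finset.mem_image.1 hT
    obtain ⟨y, hy, a, ha, hya⟩ := h T hTF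
    have hvS := hv S (Finset.mem_insert_self _ _)
    have hvT := hv T (Finset.mem_insert_of_mem hTF)
    rw [Finset.mem_sdiff] at hy
    refine ⟨y, ?_, a, Finset.mem_insert_of_mem ha, ?_⟩
    · have : y ≠ v := by rintro rfl; exact hvT hy.1
      simp [hy, this]
    · refine Finset.mem_image.2 ⟨_, hya, ?_⟩
      have : v ≠ a := by rintro rfl; exact hvS ha
      rw [Finset.erase_insert_of_ne this, Finset.insert_comm]

theorem induce_union_connected_of_inter {G : SimpleGraph V} {S T : Finset V}
    (hS : (G.induce (S : Set V)).Connected) (hT : (G.induce (T : Set V)).Connected)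
    (h : (S ∩ T).Nonempty) : (G.induce ((S ∪ T : Finset V) : Set V)).Connected := by
  obtain ⟨x, hx⟩ := h
  rw [Finset.mem_inter] at hx
  rw [Finset.coe_union]
  exact SimpleGraph.induce_union_connected hS.preconnected hT.preconnected
    ⟨x, hx.1, hx.2⟩

variable [Fintype V]

open Classical in
/-- The `n`-element vertex sets that induce a connected subgraph. -/
noncomputable def connectedFamily (G : SimpleGraph V) (n : ℕ) : Finset (Finset V) :=
  Finset.univ.filter fun S => S.card = n ∧ (G.induce (S : Set V)).Connected

theorem mem_connectedFamily {G : SimpleGraph V} {n : ℕ} {S : Finset V} :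
    S ∈ connectedFamily G n ↔ S.card = n ∧ (G.induce (S : Set V)).Connected := by
  simp [connectedFamily]

theorem connectedIdeal_eq_familyIdeal (K : Type*) [Field K] (G : SimpleGraph V) (r : ℕ) :
    connectedIdeal K G r = familyIdeal K (connectedFamily G (r + 1)) := by
  rw [connectedIdeal, familyIdeal]
  congr 1
  ext p
  simp only [Set.mem_ofPred_eq, Set.mem_image, Finset.mem_coe, mem_connectedFamily]
  constructor
  · rintro ⟨S, h₁, h₂, rfl⟩; exact ⟨S, ⟨h₁, h₂⟩, rfl⟩
  · rintro ⟨S, ⟨h₁, h₂⟩, rfl⟩; exact ⟨S, h₁, h₂, rfl⟩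

theorem exists_connected_erase {G : SimpleGraph V} {T : Finset V} (hT : 2 ≤ T.card)
    (hc : (G.induce (T : Set V)).Connected) :
    ∃ v ∈ T, (G.induce ((T.erase v : Finset V) : Set V)).Connected := by
  have : Nontrivial (T : Set V) := by
    rw [Set.nontrivial_coe_sort]
    exact Finset.one_lt_card_iff_nontrivial.1 hT
  obtain ⟨v, hv⟩ := hc.exists_connected_induce_compl_singleton_of_finite_nontrivial
  refine ⟨v, v.2, ?_⟩
  let e : ((G.induce (T : Set V)).induce {v}ᶜ) ≃g
      (G.induce ((T.erase v : Finset V) : Set V)) :=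
    { toFun := fun x => ⟨x.1.1, by
        have h₁ : (x.1 : V) ∈ T := x.1.2
        have h₂ : x.1 ≠ v := x.2
        exact Finset.mem_erase.2 ⟨fun h => h₂ (Subtype.ext h), h₁⟩⟩
      invFun := fun x => ⟨⟨x.1, Finset.mem_of_mem_erase x.2⟩, fun h =>
        Finset.ne_of_mem_erase x.2 (congrArg Subtype.val h)⟩
      left_inv := fun x => rfl
      right_inv := fun x => rfl
      map_rel_iff' := Iff.rfl }
  exact e.connected_iff.1 hv

/-- Linear quotients pass from connected `n`-sets to connected `(n + 1)`-sets. -/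
theorem LinQuot.connectedFamily_succ {G : SimpleGraph V} {n : ℕ} (hn : 2 ≤ n)
    (h : LinQuot (connectedFamily G n)) : LinQuot (connectedFamily G (n + 1)) := by
  classical
  -- An `(n + 1)`-set is listed at the moment when the first connected `n`-set contained in it
  -- appears in the order on `n`-sets.
  have key : ∀ F, LinQuot F → F ⊆ connectedFamily G n →
      LinQuot ((connectedFamily G (n + 1)).filter fun T => ∃ S ∈ F, S ⊆ T) := by
    intro F hF
    induction hF with
    | nil =>
      intro _
      rw [Finset.filter_false_of_mem (by simp)]
      exact .nil
    | cons F S hF h ih =>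
      intro hsub
      have hSc := mem_connectedFamily.1 (hsub (Finset.mem_insert_self _ _))
      have hFsub : F ⊆ connectedFamily G n := (Finset.subset_insert _ _).trans hsub
      have hU : ((connectedFamily G (n + 1)).filter fun T => ∃ S' ∈ insert S F, S' ⊆ T) =
          ((connectedFamily G (n + 1)).filter fun T => ∃ S ∈ F, S ⊆ T) ∪
          ((connectedFamily G (n + 1)).filter fun T => S ⊆ T) := by
        ext T
        simp only [Finset.mem_filter, Finset.mem_union, Finset.exists_mem_insert]
        rw [← and_or_left, or_comm (a := S ⊆ T)]
      rw [hU]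
      have hform : ∀ T ∈ connectedFamily G (n + 1), S ⊆ T → ∃ v ∉ S, insert v S = T := by
        intro T hT hST
        have hcard : (T \ S).card = 1 := by
          rw [Finset.card_sdiff_of_subset hST, (mem_connectedFamily.1 hT).1, hSc.1]
          omega
        obtain ⟨v, hv⟩ := Finset.card_eq_one.1 hcard
        have hv' : v ∈ T \ S := hv ▸ Finset.mem_singleton_self v
        refine ⟨v, (Finset.mem_sdiff.1 hv').2, ?_⟩
        rw [Finset.insert_eq, ← hv, Finset.sdiff_union_of_subset hST]
      refine (ih hFsub).union _ ?_ ?_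
      · intro T hT hTF T' hT'
        rw [Finset.mem_filter] at hT hT'
        obtain ⟨hT', S', hS', hST'⟩ := hT'
        obtain ⟨v, hv, rfl⟩ := hform T hT.1 hT.2
        obtain ⟨y, hy, a, ha, hya⟩ := h S' hS'
        rw [Finset.mem_sdiff] at hy
        -- Otherwise `T = S ∪ {v}` would contain the earlier set `S \ {a} ∪ {y}` and would already
        -- be listed. So `v` can be exchanged for `y`, giving `S ∪ {y}`.
        have hyv : y ≠ v := by
          rintro rfl
          refine hTF (Finset.mem_filter.2 ⟨hT.1, _, hya, ?_⟩)
          exact Finset.insert_subset_insert _ (Finset.erase_subset _ _)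
        refine ⟨y, ?_, v, Finset.mem_insert_self _ _, ?_⟩
        · simp [hST' hy.1, hyv, hy.2]
        · rw [Finset.erase_insert hv]
          have hS'' := mem_connectedFamily.1 (hFsub hya)
          have hunion : S ∪ insert y (S.erase a) = insert y S := by
            ext x
            simp only [Finset.mem_union, Finset.mem_insert, Finset.mem_erase]
            tauto
          -- Here `2 ≤ n` enters: the two `n`-sets share `S \ {a}`, which is then nonempty, so their
          -- union is connected.
          have hinter : (S ∩ insert y (S.erase a)).Nonempty := by
            have : 0 < (S.erase a).card := by
              rw [Finset.card_erase_of_mem ha, hSc.1]; omega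
            obtain ⟨x, hx⟩ := Finset.card_pos.1 this
            exact ⟨x, by simp [Finset.mem_of_mem_erase hx, hx]⟩
          refine Finset.mem_filter.2 ⟨mem_connectedFamily.2 ⟨?_, ?_⟩, _, hya, ?_⟩
          · rw [Finset.card_insert_of_notMem hy.2, hSc.1]
          · rw [← hunion]
            exact induce_union_connected_of_inter hSc.2 hS''.2 hinter
          · exact Finset.insert_subset_insert _ (Finset.erase_subset _ _)
      · intro T hT _ T' hT' hne
        rw [Finset.mem_filter] at hT hT'
        obtain ⟨v, hv, rfl⟩ := hform T hT.1 hT.2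
        obtain ⟨w, hw, rfl⟩ := hform T' hT'.1 hT'.2
        have hwv : w ≠ v := by rintro rfl; exact hne rfl
        refine ⟨w, by simp [hwv, hw], v, Finset.mem_insert_self _ _, ?_⟩
        rw [Finset.erase_insert hv]
  have := key _ h subset_rfl
  rwa [Finset.filter_true_of_mem] at this
  intro T hT
  have hT' := mem_connectedFamily.1 hT
  obtain ⟨v, hv, hc⟩ := exists_connected_erase (by omega) hT'.2
  refine ⟨_, mem_connectedFamily.2 ⟨?_, hc⟩, Finset.erase_subset _ _⟩
  rw [Finset.card_erase_of_mem hv, hT'.1]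
  omega

theorem LinQuot.connectedFamily_of_three {G : SimpleGraph V} (h : LinQuot (connectedFamily G 3))
    (n : ℕ) (hn : 3 ≤ n) : LinQuot (connectedFamily G n) := by
  induction n, hn using Nat.le_induction with
  | base => exact h
  | succ n hn ih => exact ih.connectedFamily_succ (by omega)

end ConnectedFamilies

/-! ### Triples with an isolated vertex -/

section Triples

variable {V : Type*}

open Classical in
/-- The triples inside `W` in which some vertex has no `H`-neighbour. In the complement of `H`
these are the connected triples. -/
noncomputable def isolatedTriples (H : SimpleGraph V) (W : Finset V) : Finset (Finset V) :=
  (W.powersetCard 3).filter fun S => ∃ q ∈ S, ∀ p ∈ S, ¬ H.Adj q p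

theorem mem_isolatedTriples {H : SimpleGraph V} {W S : Finset V} :
    S ∈ isolatedTriples H W ↔ (S ⊆ W ∧ S.card = 3) ∧ ∃ q ∈ S, ∀ p ∈ S, ¬ H.Adj q p := by
  simp only [isolatedTriples, Finset.mem_filter, Finset.mem_powersetCard]

theorem isolatedTriples_congr {H H' : SimpleGraph V} {W : Finset V}
    (h : ∀ x ∈ W, ∀ y ∈ W, H.Adj x y ↔ H'.Adj x y) :
    isolatedTriples H W = isolatedTriples H' W := by
  ext S
  rw [mem_isolatedTriples, mem_isolatedTriples]
  refine and_congr_right fun hS => exists_congr fun q => and_congr_right fun hq =>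
    forall₂_congr fun p hp => not_congr (h q (hS.1 hq) p (hS.1 hp))

/-- The neighbourhood of `v` in `H[W]` is a complete graph minus a matching. -/
def AlmostSimplicial (H : SimpleGraph V) (W : Finset V) (v : V) : Prop :=
  ∀ a ∈ W, ∀ b ∈ W, ∀ c ∈ W, H.Adj v a → H.Adj v b → H.Adj v c → a ≠ b → a ≠ c →
    ¬ H.Adj a b → ¬ H.Adj a c → b = c

variable [DecidableEq V]

theorem linQuot_star (u : V) (A : Finset V) (hu : u ∉ A) :
    LinQuot (A.image fun w => ({u, w} : Finset V)) := by
  rw [← Finset.empty_union (A.image _)]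
  refine LinQuot.nil.union _ (fun _ _ _ T hT => absurd hT (Finset.notMem_empty T)) ?_
  intro S hS _ T hT hne
  obtain ⟨w, hw, rfl⟩ := Finset.mem_image.1 hS
  obtain ⟨z, hz, rfl⟩ := Finset.mem_image.1 hT
  have h1 : z ≠ w := by rintro rfl; exact hne rfl
  have h2 : z ≠ u := by rintro rfl; exact hu hz
  have h3 : u ≠ w := by rintro rfl; exact hu hw
  refine ⟨z, by simp [h1, h2], w, by simp, ?_⟩
  have : ({u, w} : Finset V).erase w = {u} := by
    ext x; simp only [Finset.mem_erase, Finset.mem_insert, Finset.mem_singleton]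
    constructor
    · tauto
    · rintro rfl; exact ⟨h3, Or.inl rfl⟩
  rw [this]
  exact Finset.pair_comm z u

theorem exists_pair_of_mem {P : Finset V} (hP : P.card = 2) {u : V} (hu : u ∈ P) :
    ∃ w, w ≠ u ∧ P = {u, w} := by
  have : (P.erase u).card = 1 := by rw [Finset.card_erase_of_mem hu, hP]
  obtain ⟨w, hw⟩ := Finset.card_eq_one.1 this
  have hw' : w ∈ P.erase u := hw ▸ Finset.mem_singleton_self w
  exact ⟨w, Finset.ne_of_mem_erase hw', by rw [← hw, Finset.insert_erase hu]⟩

open Classical in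
/-- Edge ideals of complements of split graphs have linear quotients. -/
theorem linQuot_split (H : SimpleGraph V) (v : V) (N : Finset V) (hN : ∀ x ∈ N, H.Adj v x)
    (U : Finset V) (hU : ∀ x ∈ U, ¬ H.Adj v x) :
    LinQuot (((N ∪ U).powersetCard 2).filter
      fun P => ∃ u ∈ P, u ∈ U ∧ ∀ w ∈ P, ¬ H.Adj u w ∨ ¬ H.Adj v w) := by
  induction U using Finset.induction_on with
  | empty =>
    rw [Finset.filter_false_of_mem (by simp)]
    exact .nil
  | insert u U hu ih =>
    have hU' : ∀ x ∈ U, ¬ H.Adj v x := fun x hx => hU x (Finset.mem_insert_of_mem hx)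
    have huv : ¬ H.Adj v u := hU u (Finset.mem_insert_self _ _)
    have huN : u ∉ N ∪ U := by
      rw [Finset.mem_union, not_or]
      exact ⟨fun h => huv (hN u h), hu⟩
    set A := (N ∪ U).filter fun w => ¬ H.Adj u w ∨ ¬ H.Adj v w with hA
    have huA : u ∉ A := fun h => huN (Finset.mem_filter.1 h).1
    have hE : (((N ∪ insert u U).powersetCard 2).filter
        fun P => ∃ x ∈ P, x ∈ insert u U ∧ ∀ w ∈ P, ¬ H.Adj x w ∨ ¬ H.Adj v w) =
        (A.image fun w => ({u, w} : Finset V)) ∪ (((N ∪ U).powersetCard 2).filter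
          fun P => ∃ u ∈ P, u ∈ U ∧ ∀ w ∈ P, ¬ H.Adj u w ∨ ¬ H.Adj v w) := by
      ext P
      simp only [Finset.mem_filter, Finset.mem_union, Finset.mem_powersetCard, Finset.mem_image]
      constructor
      · rintro ⟨⟨hsub, hcard⟩, x, hx, hxU, hxw⟩
        by_cases huP : u ∈ P
        · obtain ⟨w, hwu, rfl⟩ := exists_pair_of_mem hcard huP
          refine Or.inl ⟨w, ?_, rfl⟩
          have hwNU : w ∈ N ∪ U := by
            have := hsub (show w ∈ ({u, w} : Finset V) by simp)
            simp only [Finset.mem_union, Finset.mem_insert] at this ⊢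
            tauto
          refine Finset.mem_filter.2 ⟨hwNU, ?_⟩
          simp only [Finset.mem_insert, Finset.mem_singleton] at hx
          rcases hx with rfl | rfl
          · exact hxw w (by simp)
          · exact Or.inr (hU x hxU)
        · refine Or.inr ⟨⟨fun y hy => ?_, hcard⟩, x, hx, ?_, hxw⟩
          · have := hsub hy
            have hyu : y ≠ u := by rintro rfl; exact huP hy
            simp only [Finset.mem_union, Finset.mem_insert] at this ⊢
            tauto
          · refine Finset.mem_of_mem_insert_of_ne hxU ?_
            rintro rfl; exact huP hx
      · rintro (⟨w, hw, rfl⟩ | ⟨⟨hsub, hcard⟩, x, hx, hxU, hxw⟩)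
        · rw [hA, Finset.mem_filter] at hw
          have huw : u ≠ w := by rintro rfl; exact huN hw.1
          refine ⟨⟨?_, Finset.card_pair huw⟩, u, by simp, by simp, ?_⟩
          · intro y hy
            simp only [Finset.mem_insert, Finset.mem_singleton] at hy
            rcases hy with rfl | rfl
            · simp
            · have := hw.1
              simp only [Finset.mem_union, Finset.mem_insert] at this ⊢
              tauto
          · intro y hy
            simp only [Finset.mem_insert, Finset.mem_singleton] at hy
            rcases hy with rfl | rfl
            · exact Or.inr huv
            · exact hw.2
        · refine ⟨⟨hsub.trans ?_, hcard⟩, x, hx, Finset.mem_insert_of_mem hxU, hxw⟩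
          exact Finset.union_subset_union subset_rfl (Finset.subset_insert _ _)
    rw [hE]
    -- The star of `u` goes first. Every remaining pair contains some `x ∈ U`; its other vertex can
    -- be exchanged for `u`, since two vertices of `U` always form an admissible pair.
    refine (linQuot_star u A huA).union_of_exchange (ih hU') u ?_ ?_
    · intro T hT
      obtain ⟨w, _, rfl⟩ := Finset.mem_image.1 hT
      simp
    · intro P hP
      rw [Finset.mem_filter, Finset.mem_powersetCard] at hP
      obtain ⟨⟨hsub, hcard⟩, x, hx, hxU, hxw⟩ := hP
      refine ⟨fun h => huN (hsub h), ?_⟩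
      obtain ⟨w, hwx, rfl⟩ := exists_pair_of_mem hcard hx
      refine ⟨w, by simp, Finset.mem_image.2 ⟨x, ?_, ?_⟩⟩
      · exact Finset.mem_filter.2 ⟨hsub hx, Or.inr (hU' x hxU)⟩
      · ext y
        simp only [Finset.mem_insert, Finset.mem_singleton, Finset.mem_erase]
        constructor
        · rintro (rfl | rfl)
          · exact Or.inl rfl
          · exact Or.inr ⟨hwx.symm, Or.inl rfl⟩
        · tauto

/-- The triples through `v` come first; with `v` removed they are the pairs of `linQuot_split`. A
triple `{q, p, s}` avoiding `v`, with `q` isolated, must exchange a vertex for `v`. If `v` misses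
`q`, then `q` stays isolated after `p` is replaced; if `v` meets `q` but misses `p` or `s`, that
vertex becomes isolated once the other one is replaced. Otherwise all three are neighbours of `v`,
which `AlmostSimplicial` excludes. -/
theorem linQuot_isolatedTriples_of_erase {H : SimpleGraph V} {W : Finset V} {v : V} (hv : v ∈ W)
    (hgood : AlmostSimplicial H W v) (h : LinQuot (isolatedTriples H (W.erase v))) :
    LinQuot (isolatedTriples H W) := by
  classical
  set N := (W.erase v).filter fun x => H.Adj v x with hN
  set U := (W.erase v).filter fun x => ¬ H.Adj v x with hU
  have hNU : N ∪ U = W.erase v := Finset.filter_union_filter_not_eq _ _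
  have hJ := linQuot_split H v N (fun x hx => (Finset.mem_filter.1 hx).2) U
    (fun x hx => (Finset.mem_filter.1 hx).2)
  rw [hNU] at hJ
  set J := (((W.erase v).powersetCard 2).filter
      fun P => ∃ u ∈ P, u ∈ U ∧ ∀ w ∈ P, ¬ H.Adj u w ∨ ¬ H.Adj v w) with hJdef
  have hvJ : ∀ P ∈ J, v ∉ P := by
    intro P hP hvP
    rw [hJdef, Finset.mem_filter, Finset.mem_powersetCard] at hP
    exact Finset.notMem_erase v W (hP.1.1 hvP)
  have hE : isolatedTriples H W = J.image (insert v) ∪ isolatedTriples H (W.erase v) := by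
    ext S
    rw [Finset.mem_union, mem_isolatedTriples, mem_isolatedTriples, Finset.mem_image]
    constructor
    · rintro ⟨⟨hsub, hcard⟩, q, hq, hqp⟩
      by_cases hvS : v ∈ S
      · left
        refine ⟨S.erase v, ?_, Finset.insert_erase hvS⟩
        have hcard' : (S.erase v).card = 2 := by rw [Finset.card_erase_of_mem hvS, hcard]
        refine Finset.mem_filter.2 ⟨Finset.mem_powersetCard.2
          ⟨Finset.erase_subset_erase _ hsub, hcard'⟩, ?_⟩
        have hmemU : ∀ u ∈ S.erase v, ¬ H.Adj v u → u ∈ U := fun u hu hvu =>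
          Finset.mem_filter.2 ⟨Finset.erase_subset_erase _ hsub hu, hvu⟩
        by_cases hqv : q = v
        · subst hqv
          obtain ⟨u, hu⟩ : (S.erase q).Nonempty := Finset.card_pos.1 (by omega)
          exact ⟨u, hu, hmemU u hu (hqp u (Finset.mem_of_mem_erase hu)),
            fun w hw => Or.inr (hqp w (Finset.mem_of_mem_erase hw))⟩
        · have hq' : q ∈ S.erase v := Finset.mem_erase.2 ⟨hqv, hq⟩
          exact ⟨q, hq', hmemU q hq' fun h => hqp v hvS h.symm,
            fun w hw => Or.inl (hqp w (Finset.mem_of_mem_erase hw))⟩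
      · exact Or.inr ⟨⟨Finset.subset_erase.2 ⟨hsub, hvS⟩, hcard⟩, q, hq, hqp⟩
    · rintro (⟨P, hP, rfl⟩ | ⟨⟨hsub, hcard⟩, q, hq, hqp⟩)
      · have hvP := hvJ P hP
        rw [hJdef, Finset.mem_filter, Finset.mem_powersetCard] at hP
        obtain ⟨⟨hsub, hcard⟩, u, hu, huU, huw⟩ := hP
        have huv : ¬ H.Adj v u := (Finset.mem_filter.1 huU).2
        refine ⟨⟨Finset.insert_subset hv (hsub.trans (Finset.erase_subset _ _)), ?_⟩, ?_⟩
        · rw [Finset.card_insert_of_notMem hvP, hcard]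
        · obtain ⟨w, hwu, rfl⟩ := exists_pair_of_mem hcard hu
          rcases huw w (by simp) with h1 | h1
          · refine ⟨u, by simp, fun p hp => ?_⟩
            simp only [Finset.mem_insert, Finset.mem_singleton] at hp
            rcases hp with rfl | rfl | rfl
            · exact fun h => huv h.symm
            · exact H.irrefl
            · exact h1
          · refine ⟨v, by simp, fun p hp => ?_⟩
            simp only [Finset.mem_insert, Finset.mem_singleton] at hp
            rcases hp with rfl | rfl | rfl
            · exact H.irrefl
            · exact huv
            · exact h1
      · exact ⟨⟨hsub.trans (Finset.erase_subset _ _), hcard⟩, q, hq, hqp⟩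
  have hMmem : ∀ S, S ∈ isolatedTriples H W → v ∈ S → S ∈ J.image (insert v) := by
    intro S hS hvS
    rw [hE, Finset.mem_union] at hS
    refine hS.resolve_right fun h => ?_
    exact Finset.notMem_erase v W ((mem_isolatedTriples.1 h).1.1 hvS)
  rw [hE]
  refine (hJ.image_insert v hvJ).union_of_exchange h v ?_ ?_
  · intro T hT
    obtain ⟨P, _, rfl⟩ := Finset.mem_image.1 hT
    exact Finset.mem_insert_self _ _
  · intro S hS
    obtain ⟨⟨hsub, hcard⟩, q, hq, hqp⟩ := mem_isolatedTriples.1 hS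
    have hvS : v ∉ S := fun h => Finset.notMem_erase v W (hsub h)
    have hSW : S ⊆ W := hsub.trans (Finset.erase_subset _ _)
    refine ⟨hvS, ?_⟩
    have hcard' : ∀ a ∈ S, (insert v (S.erase a)).card = 3 := by
      intro a ha
      rw [Finset.card_insert_of_notMem (fun h => hvS (Finset.mem_of_mem_erase h)),
        Finset.card_erase_of_mem ha, hcard]
    have hsub' : ∀ a, insert v (S.erase a) ⊆ W := fun a =>
      Finset.insert_subset hv ((Finset.erase_subset _ _).trans hSW)
    obtain ⟨p, s, hps, hPS⟩ := Finset.card_eq_two.1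
      (show (S.erase q).card = 2 by rw [Finset.card_erase_of_mem hq, hcard])
    have hp : p ∈ S.erase q := hPS ▸ by simp
    have hs : s ∈ S.erase q := hPS ▸ by simp
    rw [Finset.mem_erase] at hp hs
    have hS3 : ∀ x ∈ S, x = q ∨ x = p ∨ x = s := by
      intro x hx
      by_cases hxq : x = q
      · exact Or.inl hxq
      · have : x ∈ S.erase q := Finset.mem_erase.2 ⟨hxq, hx⟩
        rw [hPS] at this
        simpa [hxq] using this
    have hqv : q = v → False := fun h => hvS (h ▸ hq)
    -- erasing `x`, with a remaining vertex `t` as the isolated one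
    have main : ∀ x ∈ S, ∀ t ∈ S, t ≠ x → ¬ H.Adj v t → (∀ y ∈ S, y ≠ x → ¬ H.Adj t y) →
        ∃ a ∈ S, insert v (S.erase a) ∈ J.image (insert v) := by
      intro x hx t ht htx hvt hty
      refine ⟨x, hx, hMmem _ (mem_isolatedTriples.2 ⟨⟨hsub' x, hcard' x hx⟩, t, ?_, ?_⟩)
        (Finset.mem_insert_self _ _)⟩
      · exact Finset.mem_insert_of_mem (Finset.mem_erase.2 ⟨htx, ht⟩)
      · intro y hy
        rcases Finset.mem_insert.1 hy with rfl | hy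
        · exact fun h => hvt h.symm
        · exact hty y (Finset.mem_of_mem_erase hy) (Finset.ne_of_mem_erase hy)
    by_cases h1 : H.Adj v q
    · by_cases h2 : H.Adj v p
      · by_cases h3 : H.Adj v s
        · exact absurd (hgood q (hSW hq) p (hSW hp.2) s (hSW hs.2) h1 h2 h3 (Ne.symm hp.1)
            (Ne.symm hs.1) (hqp p hp.2) (hqp s hs.2)) hps
        · refine main p hp.2 s hs.2 hps.symm h3 fun y hy hyp => ?_
          rcases hS3 y hy with rfl | rfl | rfl
          · exact fun h => hqp s hs.2 h.symm
          · exact absurd rfl hyp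
          · exact H.irrefl
      · refine main s hs.2 p hp.2 hps h2 fun y hy hyp => ?_
        rcases hS3 y hy with rfl | rfl | rfl
        · exact fun h => hqp p hp.2 h.symm
        · exact H.irrefl
        · exact absurd rfl hyp
    · exact main p hp.2 q hq (Ne.symm hp.1) h1 fun y hy _ => hqp y hy

theorem exists_exchange_eq {S T : Finset V} (hcard : T.card = S.card) {z : V} (hz : T \ S = {z}) :
    ∃ s ∈ S, insert z (S.erase s) = T := by
  have h1 : (S \ T).card = 1 := by
    have := Finset.card_sdiff_comm hcard
    rw [← this, hz, Finset.card_singleton]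
  obtain ⟨s, hs⟩ := Finset.card_eq_one.1 h1
  have hs' : s ∈ S \ T := hs ▸ Finset.mem_singleton_self s
  rw [Finset.mem_sdiff] at hs'
  refine ⟨s, hs'.1, ?_⟩
  have hz' : z ∈ T \ S := hz ▸ Finset.mem_singleton_self z
  rw [Finset.mem_sdiff] at hz'
  ext x
  rw [Finset.mem_insert, Finset.mem_erase]
  constructor
  · rintro (rfl | ⟨h1, h2⟩)
    · exact hz'.1
    · by_contra h
      have : x ∈ S \ T := Finset.mem_sdiff.2 ⟨h2, h⟩
      rw [hs, Finset.mem_singleton] at this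
      exact h1 this
  · intro hx
    by_cases hxS : x ∈ S
    · exact Or.inr ⟨by rintro rfl; exact hs'.2 hx, hxS⟩
    · have : x ∈ T \ S := Finset.mem_sdiff.2 ⟨hx, hxS⟩
      rw [hz, Finset.mem_singleton] at this
      exact Or.inl this

/-- Linear quotients descend along the deletion of the edge `ab` when the common neighbours of
`a` and `b` form a clique and no two paths `a - y - z - b` share `y`. -/
theorem linQuot_isolatedTriples_of_edge {H H' : SimpleGraph V} {W : Finset V} {a b : V}
    (ha : a ∈ W) (hb : b ∈ W) (hab : a ≠ b) (hnab : ¬ H.Adj a b)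
    (hH' : ∀ x y, H'.Adj x y ↔ H.Adj x y ∨ (x = a ∧ y = b) ∨ (x = b ∧ y = a))
    (hclique : ∀ z ∈ W, ∀ z' ∈ W, H.Adj a z → H.Adj b z → H.Adj a z' → H.Adj b z' → z ≠ z' →
      H.Adj z z')
    (hpath : ∀ y ∈ W, ∀ z ∈ W, ∀ z' ∈ W, H.Adj a y → ¬ H.Adj b y → z ≠ a → z' ≠ a →
      H.Adj b z → H.Adj b z' → H.Adj y z → H.Adj y z' → z = z')
    (h : LinQuot (isolatedTriples H' W)) : LinQuot (isolatedTriples H W) := by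
  classical
  set Na := (W.filter fun y => H.Adj a y ∧ ¬ H.Adj b y) with hNa
  set Nb := (W.filter fun y => H.Adj b y ∧ ¬ H.Adj a y) with hNb
  have hne : ∀ y, (H.Adj a y ∧ ¬ H.Adj b y) ∨ (H.Adj b y ∧ ¬ H.Adj a y) → y ≠ a ∧ y ≠ b := by
    rintro y (⟨h1, h2⟩ | ⟨h1, h2⟩)
    · exact ⟨h1.ne', by rintro rfl; exact hnab h1⟩
    · exact ⟨by rintro rfl; exact hnab h1.symm, h1.ne'⟩
  have hba : ¬ H.Adj b a := fun h => hnab h.symm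
  set t : V → Finset V := fun y => {a, b, y} with ht
  have hmem : ∀ x y, x ∈ t y ↔ x = a ∨ x = b ∨ x = y := by intro x y; simp [ht]
  have hcard : ∀ y, y ≠ a → y ≠ b → (t y).card = 3 := by
    intro y h1 h2
    exact Finset.card_eq_three.2 ⟨a, b, y, hab, h1.symm, h2.symm, rfl⟩
  have hsubW : ∀ y ∈ W, t y ⊆ W := by
    intro y hy x hx
    rcases (hmem x y).1 hx with rfl | rfl | rfl <;> assumption
  have hnot : ∀ {x y}, ¬ H'.Adj x y → ¬ H.Adj x y := fun h h' => h ((hH' _ _).2 (Or.inl h'))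
  -- Adding `ab` destroys only triples `{a, b, y}` in which `y` meets exactly one of `a`, `b`: if it
  -- meets neither, `y` is still isolated; if both, the triple was never isolated.
  have hE : isolatedTriples H W =
      isolatedTriples H' W ∪ Na.image t ∪ Nb.image t := by
    ext S
    simp only [Finset.mem_union, mem_isolatedTriples, Finset.mem_image]
    constructor
    · rintro ⟨⟨hsub, hc⟩, q, hq, hqp⟩
      by_cases hS : a ∈ S ∧ b ∈ S
      · obtain ⟨haS, hbS⟩ := hS
        obtain ⟨y, hy⟩ : ((S.erase a).erase b).Nonempty := by
          rw [← Finset.card_pos, Finset.card_erase_of_mem (Finset.mem_erase.2 ⟨hab.symm, hbS⟩),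
            Finset.card_erase_of_mem haS, hc]
          norm_num
        simp only [Finset.mem_erase] at hy
        have hSt : t y = S := by
          refine Finset.eq_of_subset_of_card_le ?_ ?_
          · intro x hx
            rcases (hmem x y).1 hx with rfl | rfl | rfl
            exacts [haS, hbS, hy.2.2]
          · rw [hc, hcard y hy.2.1 hy.1]
        have hyW := hsub hy.2.2
        by_cases hay : H.Adj a y
        · by_cases hby : H.Adj b y
          · exfalso
            rw [← hSt, hmem] at hq
            rcases hq with rfl | rfl | rfl
            · exact hqp y hy.2.2 hay
            · exact hqp y hy.2.2 hby
            · exact hqp a haS hay.symm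
          · exact Or.inl (Or.inr ⟨y, Finset.mem_filter.2 ⟨hyW, hay, hby⟩, hSt⟩)
        · by_cases hby : H.Adj b y
          · exact Or.inr ⟨y, Finset.mem_filter.2 ⟨hyW, hby, hay⟩, hSt⟩
          · refine Or.inl (Or.inl ⟨⟨hsub, hc⟩, y, hy.2.2, fun p hp => ?_⟩)
            rw [hH']
            rw [← hSt, hmem] at hp
            rintro (h1 | ⟨h1, _⟩ | ⟨h1, _⟩)
            · rcases hp with rfl | rfl | rfl
              · exact hay h1.symm
              · exact hby h1.symm
              · exact H.irrefl h1
            · exact hy.2.1 h1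
            · exact hy.1 h1
      · refine Or.inl (Or.inl ⟨⟨hsub, hc⟩, q, hq, fun p hp => ?_⟩)
        rw [hH']
        rintro (h1 | ⟨rfl, rfl⟩ | ⟨rfl, rfl⟩)
        · exact hqp p hp h1
        · exact hS ⟨hq, hp⟩
        · exact hS ⟨hp, hq⟩
    · rintro ((⟨hS, q, hq, hqp⟩ | ⟨y, hy, rfl⟩) | ⟨y, hy, rfl⟩)
      · exact ⟨hS, q, hq, fun p hp => hnot (hqp p hp)⟩
      · obtain ⟨hyW, hay, hby⟩ := Finset.mem_filter.1 hy
        have := hne y (Or.inl ⟨hay, hby⟩)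
        refine ⟨⟨hsubW y hyW, hcard y this.1 this.2⟩, b, (hmem _ _).2 (by simp), fun p hp => ?_⟩
        rcases (hmem _ _).1 hp with rfl | rfl | rfl
        exacts [hba, H.irrefl, hby]
      · obtain ⟨hyW, hby, hay⟩ := Finset.mem_filter.1 hy
        have := hne y (Or.inr ⟨hby, hay⟩)
        refine ⟨⟨hsubW y hyW, hcard y this.1 this.2⟩, a, (hmem _ _).2 (by simp), fun p hp => ?_⟩
        rcases (hmem _ _).1 hp with rfl | rfl | rfl
        exacts [H.irrefl, hnab, hay]
  -- an exchange of `t y` that has an isolated vertex in `H'`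
  have hexch : ∀ y ∈ W, y ≠ a → y ≠ b → ∀ z ∈ W, z ∉ t y → ∀ s ∈ t y,
      (∃ q ∈ insert z ((t y).erase s), ∀ p ∈ insert z ((t y).erase s), ¬ H'.Adj q p) →
      insert z ((t y).erase s) ∈ isolatedTriples H' W := by
    intro y hy hya hyb z hz hzt s hs hq
    refine mem_isolatedTriples.2 ⟨⟨Finset.insert_subset hz
      ((Finset.erase_subset _ _).trans (hsubW y hy)), ?_⟩, hq⟩
    rw [Finset.card_insert_of_notMem (fun h => hzt (Finset.mem_of_mem_erase h)),
      Finset.card_erase_of_mem hs, hcard y hya hyb]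
  -- exchanging `s ∈ {a, b}` away leaves `{o, y, z}`, where `o` is not adjacent to `y`
  have hadj : ∀ s o, (s = a ∧ o = b) ∨ (s = b ∧ o = a) → ∀ y ∈ W, y ≠ a → y ≠ b →
      ¬ H.Adj o y → ∀ z ∈ W, z ∉ t y →
      insert z ((t y).erase s) ∉ isolatedTriples H' W → H.Adj o z ∧ H.Adj y z := by
    intro s o hso y hy hya hyb hoy z hz hzt hF
    have hz' := hzt
    rw [hmem, not_or, not_or] at hz'
    have hos : o ≠ s := by
      rcases hso with ⟨rfl, rfl⟩ | ⟨rfl, rfl⟩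
      exacts [hab.symm, hab]
    have hst : s ∈ t y := by rw [hmem]; rcases hso with ⟨rfl, rfl⟩ | ⟨rfl, rfl⟩ <;> simp
    have hot : o ∈ t y := by rw [hmem]; rcases hso with ⟨rfl, rfl⟩ | ⟨rfl, rfl⟩ <;> simp
    have hyt : y ∈ t y := by rw [hmem]; simp
    have hys : y ≠ s := by rcases hso with ⟨rfl, rfl⟩ | ⟨rfl, rfl⟩ <;> assumption
    have hyo : y ≠ o := by rcases hso with ⟨rfl, rfl⟩ | ⟨rfl, rfl⟩ <;> assumption
    have hzo : z ≠ o := by rintro rfl; exact hzt hot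
    have hzs : z ≠ s := by rintro rfl; exact hzt hst
    have hset : ∀ p ∈ insert z ((t y).erase s), p = z ∨ p = o ∨ p = y := by
      intro p hp
      rw [Finset.mem_insert, Finset.mem_erase, hmem] at hp
      rcases hso with ⟨rfl, rfl⟩ | ⟨rfl, rfl⟩ <;> tauto
    have hs_not : ∀ p ∈ insert z ((t y).erase s), p ≠ s := by
      intro p hp
      rcases hset p hp with rfl | rfl | rfl <;> assumption
    have hnadj : ∀ p ∈ insert z ((t y).erase s), ∀ q ∈ insert z ((t y).erase s),
        ¬ H.Adj p q → ¬ H'.Adj p q := by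
      intro p hp q hq hpq
      have h1 := hs_not p hp
      have h2 := hs_not q hq
      rw [hH']
      rcases hso with ⟨rfl, rfl⟩ | ⟨rfl, rfl⟩ <;> tauto
    have hoE : o ∈ insert z ((t y).erase s) :=
      Finset.mem_insert_of_mem (Finset.mem_erase.2 ⟨hos, hot⟩)
    have hyE : y ∈ insert z ((t y).erase s) :=
      Finset.mem_insert_of_mem (Finset.mem_erase.2 ⟨hys, hyt⟩)
    constructor
    · by_contra hoz
      refine hF (hexch y hy hya hyb z hz hzt s hst ⟨o, hoE, fun p hp => hnadj o hoE p hp ?_⟩)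
      rcases hset p hp with rfl | rfl | rfl
      exacts [hoz, H.irrefl, hoy]
    · by_contra hyz
      refine hF (hexch y hy hya hyb z hz hzt s hst ⟨y, hyE, fun p hp => hnadj y hyE p hp ?_⟩)
      rcases hset p hp with rfl | rfl | rfl
      exacts [hyz, fun h => hoy h.symm, H.irrefl]
  have hlast : ∀ N : Finset V, (∀ y ∈ N, y ≠ a ∧ y ≠ b) → ∀ S ∈ N.image t, ∀ T ∈ N.image t,
      T ≠ S → ∃ y ∈ T \ S, ∃ s ∈ S, insert y (S.erase s) = T := by
    intro N hN S hS T hT hTS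
    obtain ⟨y, hy, rfl⟩ := Finset.mem_image.1 hS
    obtain ⟨z, hz, rfl⟩ := Finset.mem_image.1 hT
    have hzy : z ≠ y := by rintro rfl; exact hTS rfl
    refine ⟨z, Finset.mem_sdiff.2 ⟨(hmem _ _).2 (by simp), ?_⟩, y, (hmem _ _).2 (by simp), ?_⟩
    · rw [hmem]; simp [hzy, hN z hz]
    · ext x
      rw [Finset.mem_insert, Finset.mem_erase, hmem, hmem]
      constructor
      · tauto
      · rintro (rfl | rfl | rfl)
        · exact Or.inr ⟨(hN y hy).1.symm, Or.inl rfl⟩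
        · exact Or.inr ⟨(hN y hy).2.symm, Or.inr (Or.inl rfl)⟩
        · exact Or.inl rfl
  have hNa' : ∀ y ∈ Na, y ≠ a ∧ y ≠ b := fun y hy => hne y (Or.inl (Finset.mem_filter.1 hy).2)
  have hNb' : ∀ y ∈ Nb, y ≠ a ∧ y ≠ b := fun y hy => hne y (Or.inr (Finset.mem_filter.1 hy).2)
  have hcard3 : ∀ T ∈ isolatedTriples H' W ∪ Na.image t, T ⊆ W ∧ T.card = 3 := by
    intro T hT
    have : T ∈ isolatedTriples H W := hE ▸ Finset.mem_union_left _ hT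
    exact (mem_isolatedTriples.1 this).1
  have hstepA : LinQuot (isolatedTriples H' W ∪ Na.image t) := by
    refine h.union _ ?_ fun S hS _ T hT => hlast Na hNa' S hS T hT
    intro S hS hSF T hT
    obtain ⟨y, hy, rfl⟩ := Finset.mem_image.1 hS
    obtain ⟨hya, hyb⟩ := hNa' y hy
    obtain ⟨hyW, hay, hby⟩ := Finset.mem_filter.1 hy
    obtain ⟨hTW, hT3⟩ := hcard3 T (Finset.mem_union_left _ hT)
    -- If no exchange works, every `z ∈ T \ {a, b, y}` is adjacent to both `b` and `y`. By `hpath`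
    -- there is only one such `z`, and then `T` itself is an exchange.
    by_contra hcon
    push Not at hcon
    have hz : ∀ z ∈ T \ t y, z ≠ a ∧ H.Adj b z ∧ H.Adj y z := by
      intro z hz
      have hz' := Finset.mem_sdiff.1 hz
      refine ⟨fun h => hz'.2 ((hmem _ _).2 (Or.inl h)), ?_⟩
      exact hadj a b (Or.inl ⟨rfl, rfl⟩) y hyW hya hyb hby z (hTW hz'.1) hz'.2
        (hcon z hz a ((hmem _ _).2 (Or.inl rfl)))
    have hcardT : T.card = (t y).card := by rw [hT3, hcard y hya hyb]
    obtain ⟨z, hzT⟩ : (T \ t y).Nonempty := by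
      rw [Finset.sdiff_nonempty]
      intro hsub
      exact hSF (Finset.eq_of_subset_of_card_le hsub hcardT.ge ▸ hT)
    have hsing : T \ t y = {z} := by
      refine Finset.eq_singleton_iff_unique_mem.2 ⟨hzT, fun z' hz'T => ?_⟩
      obtain ⟨h1, h2, h3⟩ := hz z hzT
      obtain ⟨h1', h2', h3'⟩ := hz z' hz'T
      exact hpath y hyW z' (hTW (Finset.mem_sdiff.1 hz'T).1) z (hTW (Finset.mem_sdiff.1 hzT).1)
        hay hby h1' h1 h2' h2 h3' h3
    obtain ⟨s, hs, hsT⟩ := exists_exchange_eq hcardT hsing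
    exact hcon z hzT s hs (hsT ▸ hT)
  rw [hE]
  refine hstepA.union _ ?_ fun S hS _ T hT => hlast Nb hNb' S hS T hT
  intro S hS hSF T hT
  obtain ⟨y, hy, rfl⟩ := Finset.mem_image.1 hS
  obtain ⟨hya, hyb⟩ := hNb' y hy
  obtain ⟨hyW, hby, hay⟩ := Finset.mem_filter.1 hy
  obtain ⟨hTW, hT3⟩ := hcard3 T hT
  by_contra hcon
  push Not at hcon
  -- A vertex `z` adjacent to `a` but not to `b` would give `{a, b, z}`, which is already listed. So
  -- an obstructing `z` is adjacent to all of `a`, `b`, `y`.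
  have hz : ∀ z ∈ T \ t y, H.Adj a z ∧ H.Adj b z ∧ H.Adj y z := by
    intro z hz
    have hz' := Finset.mem_sdiff.1 hz
    obtain ⟨haz, hyz⟩ := hadj b a (Or.inr ⟨rfl, rfl⟩) y hyW hya hyb hay z (hTW hz'.1) hz'.2
      fun h => hcon z hz b ((hmem _ _).2 (by simp)) (Finset.mem_union_left _ h)
    refine ⟨haz, ?_, hyz⟩
    by_contra hbz
    refine hcon z hz y ((hmem _ _).2 (by simp)) (Finset.mem_union_right _ ?_)
    refine Finset.mem_image.2 ⟨z, Finset.mem_filter.2 ⟨hTW hz'.1, haz, hbz⟩, ?_⟩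
    ext x
    rw [hmem, Finset.mem_insert, Finset.mem_erase, hmem]
    constructor
    · rintro (rfl | rfl | rfl)
      · exact Or.inr ⟨hya.symm, Or.inl rfl⟩
      · exact Or.inr ⟨hyb.symm, Or.inr (Or.inl rfl)⟩
      · exact Or.inl rfl
    · tauto
  have hcardT : T.card = (t y).card := by rw [hT3, hcard y hya hyb]
  obtain ⟨z, hzT⟩ : (T \ t y).Nonempty := by
    rw [Finset.sdiff_nonempty]
    intro hsub
    exact hSF (Finset.eq_of_subset_of_card_le hsub hcardT.ge ▸ hT)
  have hTH : T ∈ isolatedTriples H W := hE ▸ Finset.mem_union_left _ hT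
  obtain ⟨q, hq, hqp⟩ := (mem_isolatedTriples.1 hTH).2
  -- The isolated vertex `q` of `T` lies outside `{a, b, y}`. Any further vertex of `T` outside
  -- would be another common neighbour of `a` and `b`, hence adjacent to `q` by `hclique`.
  by_cases hqt : q ∈ t y
  · obtain ⟨h1, h2, h3⟩ := hz z hzT
    have hzT' := (Finset.mem_sdiff.1 hzT).1
    rcases (hmem _ _).1 hqt with rfl | rfl | rfl
    exacts [hqp z hzT' h1, hqp z hzT' h2, hqp z hzT' h3]
  · have hqT : q ∈ T \ t y := Finset.mem_sdiff.2 ⟨hq, hqt⟩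
    have hsing : T \ t y = {q} := by
      refine Finset.eq_singleton_iff_unique_mem.2 ⟨hqT, fun z' hz'T => ?_⟩
      by_contra hne'
      obtain ⟨h1, h2, _⟩ := hz q hqT
      obtain ⟨h1', h2', _⟩ := hz z' hz'T
      have hz'T' := (Finset.mem_sdiff.1 hz'T).1
      exact hqp z' hz'T' (hclique q (hTW hq) z' (hTW hz'T') h1 h2 h1' h2' (Ne.symm hne'))
    obtain ⟨s, hs, hsT⟩ := exists_exchange_eq hcardT hsing
    exact hcon q hqT s hs (hsT ▸ hT)

end Triples

/-! ### Perfect elimination -/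

section PerfectElimination

variable {V : Type*}

/-- The neighbours of `v` in `D` form a clique. -/
def SimplicialIn (H : SimpleGraph V) (D : Finset V) (v : V) : Prop :=
  ∀ x ∈ D, ∀ y ∈ D, H.Adj v x → H.Adj v y → x ≠ y → H.Adj x y

theorem SimplicialIn.mono {H : SimpleGraph V} {D E : Finset V} {v : V} (h : SimplicialIn H D v)
    (hE : E ⊆ D) : SimplicialIn H E v :=
  fun x hx y hy => h x (hE hx) y (hE hy)

theorem SimplicialIn.almostSimplicial {H : SimpleGraph V} {D : Finset V} {v : V}
    (h : SimplicialIn H D v) : AlmostSimplicial H D v :=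
  fun a ha b hb _ _ hva hvb _ hab _ hnab _ => absurd (h a ha b hb hva hvb hab) hnab

/-- The graph `H` with all edges from `s` to `X` added. -/
def addStar (H : SimpleGraph V) (s : V) (X : Finset V) : SimpleGraph V where
  Adj x y := H.Adj x y ∨ (x ≠ y ∧ ((x = s ∧ y ∈ X) ∨ (y = s ∧ x ∈ X)))
  symm := ⟨fun x y h => by
    rcases h with h | ⟨h1, h2⟩
    · exact Or.inl h.symm
    · exact Or.inr ⟨h1.symm, h2.symm⟩⟩
  loopless := ⟨fun x h => by
    rcases h with h | ⟨h1, _⟩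
    · exact H.irrefl h
    · exact h1 rfl⟩

theorem addStar_adj {H : SimpleGraph V} {s : V} {X : Finset V} {x y : V} :
    (addStar H s X).Adj x y ↔
      H.Adj x y ∨ (x ≠ y ∧ ((x = s ∧ y ∈ X) ∨ (y = s ∧ x ∈ X))) := Iff.rfl

theorem addStar_adj_of_ne {H : SimpleGraph V} {s : V} {X : Finset V} {x y : V} (hx : x ≠ s)
    (hy : y ≠ s) : (addStar H s X).Adj x y ↔ H.Adj x y := by
  rw [addStar_adj]; tauto

variable [DecidableEq V]

/-- `H[D]` has a perfect elimination ordering. -/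
inductive PerfectElim (H : SimpleGraph V) : Finset V → Prop
  | nil : PerfectElim H ∅
  | cons (D : Finset V) (v : V) (hv : v ∉ D) (hD : PerfectElim H D) (h : SimplicialIn H D v) :
      PerfectElim H (insert v D)

theorem PerfectElim.mono {H : SimpleGraph V} {D : Finset V} (hD : PerfectElim H D) :
    ∀ E ⊆ D, PerfectElim H E := by
  induction hD with
  | nil => intro E hE; rw [Finset.subset_empty.1 hE]; exact .nil
  | cons D v hv hD h ih =>
    intro E hE
    by_cases hvE : v ∈ E
    · have hsub : E.erase v ⊆ D := by
        intro x hx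
        exact Finset.mem_of_mem_insert_of_ne (hE (Finset.mem_of_mem_erase hx))
          (Finset.ne_of_mem_erase hx)
      rw [← Finset.insert_erase hvE]
      exact .cons _ _ (Finset.notMem_erase _ _) (ih _ hsub) (h.mono hsub)
    · exact ih E fun x hx => Finset.mem_of_mem_insert_of_ne (hE hx) (by rintro rfl; exact hvE hx)

theorem PerfectElim.congr {H H' : SimpleGraph V} {D : Finset V} (hD : PerfectElim H D) :
    (∀ x ∈ D, ∀ y ∈ D, H.Adj x y ↔ H'.Adj x y) → PerfectElim H' D := by
  induction hD with
  | nil => intro _; exact .nil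
  | cons D v hv hD h ih =>
    intro hH
    have hm : ∀ x ∈ D, x ∈ insert v D := fun x => Finset.mem_insert_of_mem
    have hv' := Finset.mem_insert_self v D
    refine .cons _ _ hv (ih fun x hx y hy => hH x (hm x hx) y (hm y hy)) fun x hx y hy h1 h2 h3 => ?_
    rw [← hH _ (hm x hx) _ (hm y hy)]
    exact h x hx y hy ((hH _ hv' _ (hm x hx)).2 h1) ((hH _ hv' _ (hm y hy)).2 h2) h3

/-- A graph with a perfect elimination ordering is complete or has two nonadjacent simplicial
vertices. -/
theorem PerfectElim.complete_or_simplicial {H : SimpleGraph V} {D : Finset V}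
    (hD : PerfectElim H D) :
    (∀ x ∈ D, ∀ y ∈ D, x ≠ y → H.Adj x y) ∨
      ∃ x ∈ D, ∃ y ∈ D, x ≠ y ∧ ¬ H.Adj x y ∧ SimplicialIn H D x ∧ SimplicialIn H D y := by
  induction hD with
  | nil => left; simp
  | cons D v hv hD h ih =>
    have hvs : SimplicialIn H (insert v D) v := by
      intro x hx y hy hvx hvy
      exact h x (Finset.mem_of_mem_insert_of_ne hx hvx.ne')
        y (Finset.mem_of_mem_insert_of_ne hy hvy.ne') hvx hvy
    have hext : ∀ w, ¬ H.Adj v w → SimplicialIn H D w → SimplicialIn H (insert v D) w := by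
      intro w hvw hw x hx y hy hwx hwy
      refine hw x (Finset.mem_of_mem_insert_of_ne hx ?_) y
        (Finset.mem_of_mem_insert_of_ne hy ?_) hwx hwy
      · rintro rfl; exact hvw hwx.symm
      · rintro rfl; exact hvw hwy.symm
    -- The new vertex `v` is one member of the pair. A simplicial vertex of `D` not adjacent to `v`
    -- stays simplicial and is the other.
    have hmain : ∀ w ∈ D, ¬ H.Adj v w → SimplicialIn H D w →
        ∃ x ∈ insert v D, ∃ y ∈ insert v D, x ≠ y ∧ ¬ H.Adj x y ∧
          SimplicialIn H (insert v D) x ∧ SimplicialIn H (insert v D) y := by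
      intro w hw hvw hs
      exact ⟨v, Finset.mem_insert_self _ _, w, Finset.mem_insert_of_mem hw,
        by rintro rfl; exact hv hw, hvw, hvs, hext w hvw hs⟩
    rcases ih with hc | ⟨x, hx, y, hy, hxy, hnxy, hxs, hys⟩
    · by_cases hall : ∀ w ∈ D, H.Adj v w
      · left
        intro x hx y hy hxy
        rcases Finset.mem_insert.1 hx with rfl | hxD
        · exact hall y (Finset.mem_of_mem_insert_of_ne hy hxy.symm)
        · rcases Finset.mem_insert.1 hy with rfl | hyD
          · exact (hall x hxD).symm
          · exact hc x hxD y hyD hxy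
      · push Not at hall
        obtain ⟨w, hw, hvw⟩ := hall
        exact Or.inr (hmain w hw hvw fun x hx y hy _ _ => hc x hx y hy)
    · right
      by_cases hvx : H.Adj v x
      · by_cases hvy : H.Adj v y
        · exact absurd (h x hx y hy hvx hvy hxy) hnxy
        · exact hmain y hy hvy hys
      · exact hmain x hx hvx hxs

theorem PerfectElim.exists_simplicial_ne {H : SimpleGraph V} {D : Finset V}
    (hD : PerfectElim H D) (x : V) (hne : ∃ y ∈ D, y ≠ x) :
    ∃ v ∈ D, v ≠ x ∧ SimplicialIn H D v := by
  rcases hD.complete_or_simplicial with hc | ⟨a, ha, b, hb, hab, _, has, hbs⟩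
  · obtain ⟨y, hy, hyx⟩ := hne
    exact ⟨y, hy, hyx, fun a ha b hb _ _ => hc a ha b hb⟩
  · by_cases hax : a = x
    · exact ⟨b, hb, fun h => hab (hax.trans h.symm), hbs⟩
    · exact ⟨a, ha, hax, has⟩

theorem addStar_insert_adj {H : SimpleGraph V} {s b : V} {X : Finset V} (hb : b ≠ s) {x y : V} :
    (addStar H s (insert b X)).Adj x y ↔
      (addStar H s X).Adj x y ∨ (x = s ∧ y = b) ∨ (x = b ∧ y = s) := by
  rw [addStar_adj, addStar_adj, Finset.mem_insert, Finset.mem_insert]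
  constructor
  · rintro (h | ⟨h1, ⟨rfl, rfl | h⟩ | ⟨rfl, rfl | h⟩⟩)
    · exact Or.inl (Or.inl h)
    · exact Or.inr (Or.inl ⟨rfl, rfl⟩)
    · exact Or.inl (Or.inr ⟨h1, Or.inl ⟨rfl, h⟩⟩)
    · exact Or.inr (Or.inr ⟨rfl, rfl⟩)
    · exact Or.inl (Or.inr ⟨h1, Or.inr ⟨rfl, h⟩⟩)
  · rintro ((h | ⟨h1, ⟨rfl, h⟩ | ⟨rfl, h⟩⟩) | ⟨rfl, rfl⟩ | ⟨rfl, rfl⟩)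
    · exact Or.inl h
    · exact Or.inr ⟨h1, Or.inl ⟨rfl, Or.inr h⟩⟩
    · exact Or.inr ⟨h1, Or.inr ⟨rfl, Or.inr h⟩⟩
    · exact Or.inr ⟨hb.symm, Or.inl ⟨rfl, Or.inl rfl⟩⟩
    · exact Or.inr ⟨hb, Or.inr ⟨rfl, Or.inl rfl⟩⟩

/-- Linear quotients for the triples in `W` follow from those in `W \ (D \ {s, x})` if `H[D]` has
a perfect elimination ordering and is attached to the rest of `W` only at `s` and `x`. -/
theorem linQuot_isolatedTriples_of_attached {D : Finset V} :
    ∀ {H : SimpleGraph V} {W : Finset V} {s x : V}, D ⊆ W → s ∈ D → x ∈ D → s ≠ x →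
      (∀ p ∈ D, p ≠ s → p ≠ x → ∀ q ∈ W, H.Adj p q → q ∈ D) → PerfectElim H D →
      LinQuot (isolatedTriples H (W \ (D \ {s, x}))) → LinQuot (isolatedTriples H W) := by
  induction hn : D.card using Nat.strong_induction_on generalizing D with
  | _ n ih =>
  intro H W s x hDW hs hx hsx hprivate hPE hLQ
  by_cases hD : ∀ p ∈ D, p = s ∨ p = x
  · have : W \ (D \ {s, x}) = W := by
      have h0 : D \ {s, x} = ∅ := Finset.sdiff_eq_empty_iff_subset.2 fun p hp => by
        simpa using hD p hp
      rw [h0, Finset.sdiff_empty]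
    rwa [this] at hLQ
  push Not at hD
  obtain ⟨p₀, hp₀, hp₀s, hp₀x⟩ := hD
  -- deleting a vertex of `D` other than `s` and `x`
  have hdel : ∀ {H' : SimpleGraph V} {v : V}, v ∈ D → v ≠ s → v ≠ x →
      (∀ p ∈ D, p ≠ s → p ≠ x → ∀ q ∈ W, H'.Adj p q → q ∈ D) → PerfectElim H' (D.erase v) →
      (∀ y ∈ W \ (D \ {s, x}), ∀ z ∈ W \ (D \ {s, x}), H.Adj y z ↔ H'.Adj y z) →
      AlmostSimplicial H' W v → LinQuot (isolatedTriples H' W) := by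
    intro H' v hv hvs hvx hpriv hPE' hcongr hgood
    refine linQuot_isolatedTriples_of_erase (hDW hv) hgood ?_
    refine ih (D.erase v).card ?_ rfl (Finset.erase_subset_erase _ hDW)
      (Finset.mem_erase.2 ⟨hvs.symm, hs⟩) (Finset.mem_erase.2 ⟨hvx.symm, hx⟩) hsx ?_ hPE' ?_
    · rw [← hn]; exact Finset.card_erase_lt_of_mem hv
    · intro p hp hps hpx q hq hpq
      exact Finset.mem_erase.2 ⟨Finset.ne_of_mem_erase hq,
        hpriv p (Finset.mem_of_mem_erase hp) hps hpx q (Finset.mem_of_mem_erase hq) hpq⟩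
    · have : W.erase v \ (D.erase v \ {s, x}) = W \ (D \ {s, x}) := by
        ext y
        simp only [Finset.mem_sdiff, Finset.mem_erase, Finset.mem_insert, Finset.mem_singleton]
        by_cases hyv : y = v
        · subst hyv; tauto
        · tauto
      rw [this, ← isolatedTriples_congr hcongr]
      exact hLQ
  -- a private vertex that is simplicial in `D` can be deleted directly
  have hsimp : ∀ v ∈ D, v ≠ s → v ≠ x → SimplicialIn H D v → LinQuot (isolatedTriples H W) := by
    intro v hv hvs hvx hvD
    refine hdel hv hvs hvx hprivate (hPE.mono _ (Finset.erase_subset _ _)) (fun _ _ _ _ => Iff.rfl)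
      (SimplicialIn.almostSimplicial fun a ha b hb hva hvb => ?_)
    exact hvD a (hprivate v hv hvs hvx a ha hva) b (hprivate v hv hvs hvx b hb hvb) hva hvb
  -- The hard case has `s` as a simplicial vertex of `D` and a vertex `v` adjacent to `s` that is
  -- simplicial only after `s` is removed.
  obtain ⟨v₀, hv₀, hv₀x, hv₀D⟩ := hPE.exists_simplicial_ne x ⟨s, hs, hsx⟩
  by_cases hv₀s : v₀ = s
  swap
  · exact hsimp v₀ hv₀ hv₀s hv₀x hv₀D
  subst hv₀s
  obtain ⟨v, hv, hvx, hvD⟩ := (hPE.mono (D.erase v₀) (Finset.erase_subset _ _)).exists_simplicial_ne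
    x ⟨p₀, Finset.mem_erase.2 ⟨hp₀s, hp₀⟩, hp₀x⟩
  obtain ⟨hvs, hvD'⟩ := Finset.mem_erase.1 hv
  by_cases hadj : H.Adj v₀ v
  swap
  · refine hsimp v hvD' hvs hvx fun a ha b hb hva hvb => hvD a (Finset.mem_erase.2 ⟨?_, ha⟩) b
      (Finset.mem_erase.2 ⟨?_, hb⟩) hva hvb
    · rintro rfl; exact hadj hva.symm
    · rintro rfl; exact hadj hvb.symm
  classical
  set R := (D.erase v₀).filter fun y => H.Adj v y with hR
  -- Joining `s` to all neighbours of `v` in `D` except `x` makes the neighbourhood of `v` complete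
  -- up to the pair `s, x`. The vertex `x` is left out so that the graph outside the private part of
  -- `D` does not change.
  set X := R.erase x with hX
  have hRmem : ∀ y, y ∈ R ↔ (y ≠ v₀ ∧ y ∈ D) ∧ H.Adj v y := by
    intro y; rw [hR, Finset.mem_filter, Finset.mem_erase]
  have hXmem : ∀ y, y ∈ X ↔ y ≠ x ∧ (y ≠ v₀ ∧ y ∈ D) ∧ H.Adj v y := by
    intro y; rw [hX, Finset.mem_erase, hRmem]
  have hRclique : ∀ y ∈ R, ∀ z ∈ R, y ≠ z → H.Adj y z := by
    intro y hy z hz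
    rw [hRmem] at hy hz
    exact hvD y (Finset.mem_erase.2 hy.1) z (Finset.mem_erase.2 hz.1) hy.2 hz.2
  have hRv : ∀ y, y ∈ R ∨ y = v → ∀ z, z ∈ R ∨ z = v → y ≠ z → H.Adj y z := by
    rintro y (hy | rfl) z (hz | rfl) hyz
    · exact hRclique y hy z hz hyz
    · exact ((hRmem y).1 hy).2.symm
    · exact ((hRmem z).1 hz).2
    · exact absurd rfl hyz
  -- neighbours of `v₀` inside `D`
  have hQ : ∀ y ∈ D, H.Adj v₀ y → y ∈ R ∨ y = v := by
    intro y hy hsy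
    by_cases hyv : y = v
    · exact Or.inr hyv
    · exact Or.inl ((hRmem y).2 ⟨⟨hsy.ne', hy⟩, (hv₀D y hy v hvD' hsy hadj hyv).symm⟩)
  have hpriv : ∀ Y ⊆ X, ∀ p ∈ D, p ≠ v₀ → p ≠ x → ∀ q ∈ W, (addStar H v₀ Y).Adj p q → q ∈ D := by
    intro Y _ p hp hps hpx q hq hpq
    rcases addStar_adj.1 hpq with h | ⟨_, ⟨h, _⟩ | ⟨h, _⟩⟩
    · exact hprivate p hp hps hpx q hq h
    · exact absurd h hps
    · exact h ▸ hs
  have hQ' : ∀ Y ⊆ X, ∀ y ∈ D, (addStar H v₀ Y).Adj v₀ y → y ∈ R ∨ y = v := by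
    intro Y hY y hy hsy
    rcases addStar_adj.1 hsy with h | ⟨hne, ⟨_, h⟩ | ⟨h, _⟩⟩
    · exact hQ y hy h
    · exact Or.inl (Finset.mem_of_mem_erase (hY h))
    · exact absurd h.symm hne
  have hle : ∀ (Y : Finset V) {y z}, H.Adj y z → (addStar H v₀ Y).Adj y z :=
    fun Y y z h => addStar_adj.2 (Or.inl h)
  suffices hfull : LinQuot (isolatedTriples (addStar H v₀ X) W) by
    have hstep : ∀ Y ⊆ X, LinQuot (isolatedTriples (addStar H v₀ Y) W) →
        LinQuot (isolatedTriples H W) := by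
      intro Y
      induction Y using Finset.induction_on with
      | empty =>
        intro _ h
        rwa [isolatedTriples_congr (H' := H)] at h
        intro y _ z _
        rw [addStar_adj]
        simp
      | insert b Y hbY ihY =>
        intro hY h
        have hYX : Y ⊆ X := (Finset.subset_insert _ _).trans hY
        have hbX : b ∈ X := hY (Finset.mem_insert_self _ _)
        obtain ⟨hbx, ⟨hbs, hbD⟩, hvb⟩ := (hXmem b).1 hbX
        have hbR : b ∈ R := Finset.mem_of_mem_erase hbX
        refine ihY hYX ?_
        by_cases hsb : H.Adj v₀ b
        · rwa [isolatedTriples_congr (H' := addStar H v₀ Y)] at h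
          intro y _ z _
          rw [addStar_insert_adj hbs, or_iff_left_iff_imp]
          rintro (⟨rfl, rfl⟩ | ⟨rfl, rfl⟩)
          exacts [hle Y hsb, hle Y hsb.symm]
        refine linQuot_isolatedTriples_of_edge (a := v₀) (b := b) (hDW hs) (hDW hbD) hbs.symm
          ?_ ?_ ?_ ?_ h
        · rw [addStar_adj]
          rintro (h | ⟨_, ⟨_, h⟩ | ⟨h, _⟩⟩)
          exacts [hsb h, hbY h, hbs h]
        · exact fun y z => addStar_insert_adj hbs
        -- Since `b` is private, common neighbours of `s` and `b` lie in `D`; those of `s` there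
        -- belong to the clique `R ∪ {v}`.
        · intro z hz z' hz' h1 h2 h1' h2' hne
          have hzD := hpriv Y hYX b hbD hbs hbx z hz h2
          have hzD' := hpriv Y hYX b hbD hbs hbx z' hz' h2'
          exact hle Y (hRv z (hQ' Y hYX z hzD h1) z' (hQ' Y hYX z' hzD' h1') hne)
        -- Here `y` lies outside `D`, since inside it would belong to the clique containing `b`. A
        -- vertex other than `s` joining the private vertex `b` to the outside can only be `x`, so
        -- `z = z' = x`.
        · intro y hy z hz z' hz' hay hby hzs hzs' hbz hbz' hyz hyz'
          have hyD : y ∉ D := by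
            intro hyD
            have hyb : b ≠ y := by
              rintro rfl
              rcases addStar_adj.1 hay with h | ⟨_, ⟨_, h⟩ | ⟨h, _⟩⟩
              exacts [hsb h, hbY h, hbs h]
            exact hby (hle Y (hRv b (Or.inl hbR) y (hQ' Y hYX y hyD hay) hyb))
          have hx' : ∀ w ∈ W, w ≠ v₀ → (addStar H v₀ Y).Adj b w → (addStar H v₀ Y).Adj y w →
              w = x := by
            intro w hw hws hbw hyw
            by_contra hwx
            have hwD := hpriv Y hYX b hbD hbs hbx w hw hbw
            exact hyD (hpriv Y hYX w hwD hws hwx y hy hyw.symm)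
          rw [hx' z hz hzs hbz hyz, hx' z' hz' hzs' hbz' hyz']
    exact hstep X subset_rfl hfull
  refine hdel hvD' hvs hvx (hpriv X subset_rfl) ?_ ?_ ?_
  · have hsub : (D.erase v₀).erase v ⊆ D := (Finset.erase_subset _ _).trans (Finset.erase_subset _ _)
    have hPE' : PerfectElim (addStar H v₀ X) ((D.erase v₀).erase v) := by
      refine (hPE.mono _ hsub).congr fun y hy z hz => (addStar_adj_of_ne ?_ ?_).symm
      · exact Finset.ne_of_mem_erase (Finset.mem_of_mem_erase hy)
      · exact Finset.ne_of_mem_erase (Finset.mem_of_mem_erase hz)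
    have heq : D.erase v = insert v₀ ((D.erase v₀).erase v) := by
      rw [Finset.erase_right_comm, Finset.insert_erase (Finset.mem_erase.2 ⟨hvs.symm, hs⟩)]
    rw [heq]
    -- The added star keeps the neighbours of `s` in `D` within the clique `R ∪ {v}`, so `s` remains
    -- simplicial and may be put last.
    refine .cons _ _ (fun h => ?_) hPE' fun y hy z hz hsy hsz hyz => ?_
    · exact Finset.notMem_erase v₀ D (Finset.mem_of_mem_erase h)
    · exact hle X (hRv y (hQ' X subset_rfl y (hsub hy) hsy) z (hQ' X subset_rfl z (hsub hz) hsz) hyz)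
  · intro y hy z hz
    have hX' : ∀ w ∈ W \ (D \ {v₀, x}), w ∉ X := by
      intro w hw hwX
      obtain ⟨h1, ⟨h2, h3⟩, _⟩ := (hXmem w).1 hwX
      rw [Finset.mem_sdiff] at hw
      exact hw.2 (Finset.mem_sdiff.2 ⟨h3, by simp [h1, h2]⟩)
    have h1 := hX' y hy
    have h2 := hX' z hz
    rw [addStar_adj]
    tauto
  · have hN : ∀ y ∈ W, (addStar H v₀ X).Adj v y → y = v₀ ∨ y ∈ R := by
      intro y hy hvy
      by_cases hys : y = v₀
      · exact Or.inl hys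
      · have := (addStar_adj_of_ne hvs hys).1 hvy
        exact Or.inr ((hRmem y).2 ⟨⟨hys, hprivate v hvD' hvs hvx y hy this⟩, this⟩)
    have hsR : ∀ y ∈ R, y ≠ x → (addStar H v₀ X).Adj v₀ y := by
      intro y hy hyx
      exact addStar_adj.2 (Or.inr ⟨((hRmem y).1 hy).1.1.symm, Or.inl
        ⟨rfl, Finset.mem_erase.2 ⟨hyx, hy⟩⟩⟩)
    intro a ha b hb c hc hva hvb hvc hab hac hnab hnac
    -- The only possible nonadjacent pair among the neighbours of `v` is `s, x`, so the complement
    -- of this neighbourhood is a matching.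
    have hkey : ∀ b ∈ W, (addStar H v₀ X).Adj v b → a ≠ b → ¬ (addStar H v₀ X).Adj a b →
        (a = v₀ ∧ b = x) ∨ (a = x ∧ b = v₀) := by
      intro b hb hvb hab hnab
      rcases hN a ha hva with rfl | haR <;> rcases hN b hb hvb with rfl | hbR
      · exact absurd rfl hab
      · exact Or.inl ⟨rfl, by_contra fun h => hnab (hsR b hbR h)⟩
      · exact Or.inr ⟨by_contra fun h => hnab (hsR a haR h).symm, rfl⟩
      · exact absurd (hle X (hRclique a haR b hbR hab)) hnab
    have h1 := hkey b hb hvb hab hnab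
    have h2 := hkey c hc hvc hac hnac
    rcases h1 with ⟨rfl, rfl⟩ | ⟨rfl, rfl⟩ <;> rcases h2 with ⟨h, rfl⟩ | ⟨h, rfl⟩
    · rfl
    · exact absurd h hsx
    · exact absurd h.symm hsx
    · rfl

end PerfectElimination

/-! ### Chordal graphs have perfect elimination orderings -/

section Chordal

variable {V : Type*}

/-- A path from `p` to `q` of length `k` with interior in `C`. -/
def HasPathThrough (H : SimpleGraph V) (C : V → Prop) (p q : V) (k : ℕ) : Prop :=
  ∃ w : ℕ → V, w 0 = p ∧ w k = q ∧ (∀ i < k, H.Adj (w i) (w (i + 1))) ∧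
    ∀ i, 0 < i → i < k → C (w i)

theorem exists_path_of_reflTransGen {H : SimpleGraph V} {C : V → Prop} {c c' : V} (hc : C c)
    (h : Relation.ReflTransGen (fun a b => H.Adj a b ∧ C a ∧ C b) c c') :
    ∃ (k : ℕ) (w : ℕ → V), w 0 = c ∧ w k = c' ∧ (∀ i < k, H.Adj (w i) (w (i + 1))) ∧
      ∀ i ≤ k, C (w i) := by
  induction h with
  | refl => exact ⟨0, fun _ => c, rfl, rfl, fun i hi => absurd hi (Nat.not_lt_zero i), fun _ _ => hc⟩
  | @tail b d _ hbd ih =>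
    obtain ⟨k, w, h0, hk, hadj, hC⟩ := ih
    refine ⟨k + 1, fun i => if i ≤ k then w i else d, by simpa using h0, by simp, ?_, ?_⟩
    · intro i hi
      by_cases hik : i + 1 ≤ k
      · simpa [hik, show i ≤ k by omega] using hadj i (by omega)
      · obtain rfl : i = k := by omega
        simpa [hk] using hbd.1
    · intro i hi
      by_cases hik : i ≤ k
      · simpa [hik] using hC i hik
      · simpa [hik] using hbd.2.2

/-- A shortest path is induced: a repetition or a chord would allow a shortcut whose interior still
lies in `C`. -/
theorem HasPathThrough.exists_induced {H : SimpleGraph V} {C : V → Prop} {p q : V}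
    (h : ∃ k, HasPathThrough H C p q k) :
    ∃ (k : ℕ) (w : ℕ → V), w 0 = p ∧ w k = q ∧ (∀ i < k, H.Adj (w i) (w (i + 1))) ∧
      (∀ i, 0 < i → i < k → C (w i)) ∧
      ∀ i j, i < j → j ≤ k → w i ≠ w j ∧ (H.Adj (w i) (w j) → j = i + 1) := by
  classical
  have hmin : ∀ m < Nat.find h, ¬ HasPathThrough H C p q m := fun m hm => Nat.find_min h hm
  obtain ⟨w, h0, hk, hadj, hC⟩ := Nat.find_spec h
  set k := Nat.find h
  refine ⟨k, w, h0, hk, hadj, hC, fun i j hij hjk => ?_⟩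
  -- `s` steps of the path may be skipped after position `i`
  have hskip : ∀ i s, 0 < s → i + s ≤ k → (i + s < k → H.Adj (w i) (w (i + s + 1))) →
      (i + s = k → w i = q) → False := by
    intro i s hs his hstep hend
    refine hmin (k - s) (by omega) ⟨fun t => if t ≤ i then w t else w (t + s), by simpa using h0,
      ?_, ?_, ?_⟩
    · by_cases h : k - s ≤ i
      · have : i + s = k := by omega
        have h' : k - s = i := by omega
        simp [h', hend this]
      · simp only [h, if_false]
        rw [show k - s + s = k by omega, hk]
    · intro t ht
      by_cases h1 : t + 1 ≤ i
      · simpa [h1, show t ≤ i by omega] using hadj t (by omega)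
      · by_cases h2 : t ≤ i
        · obtain rfl : t = i := by omega
          have := hstep (by omega)
          simpa [show t + 1 + s = t + s + 1 by omega] using this
        · have := hadj (t + s) (by omega)
          simpa [h1, h2, show t + 1 + s = t + s + 1 by omega] using this
    · intro t ht htk
      by_cases h2 : t ≤ i
      · simpa [h2] using hC t ht (by omega)
      · simpa [h2] using hC (t + s) (by omega) (by omega)
  constructor
  · intro heq
    refine hskip i (j - i) (by omega) (by omega) (fun h => ?_) (fun h => ?_)
    · rw [heq, show i + (j - i) = j by omega]
      exact hadj j (by omega)
    · rw [heq, ← hk]; congr 1; omega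
  · intro hij'
    by_contra hne
    refine hskip i (j - i - 1) (by omega) (by omega) (fun h => ?_) (fun h => by omega)
    rwa [show i + (j - i - 1) + 1 = j by omega]

/-- `H` has no induced cycle of length at least four inside `D`. -/
def NoHole (H : SimpleGraph V) (D : Finset V) : Prop :=
  ∀ n, 4 ≤ n → ∀ f : SimpleGraph.cycleGraph n ↪g H, ¬ ∀ i, f i ∈ D

theorem NoHole.mono {H : SimpleGraph V} {D E : Finset V} (h : NoHole H D) (hE : E ⊆ D) :
    NoHole H E :=
  fun n hn f hf => h n hn f fun i => hE (hf i)

theorem cycleGraph_adj_iff {k : ℕ} (i j : Fin (k + 2)) :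
    (SimpleGraph.cycleGraph (k + 2)).Adj i j ↔
      (i.1 + 1 = j.1 ∨ j.1 + 1 = i.1 ∨ (i.1 = 0 ∧ j.1 = k + 1) ∨ (j.1 = 0 ∧ i.1 = k + 1)) := by
  have hi := i.2
  have hj := j.2
  rw [SimpleGraph.cycleGraph_adj', Fin.sub_def, Fin.sub_def]
  simp only
  have h : ∀ a b : ℕ, a < k + 2 → b < k + 2 → ((k + 2 - b + a) % (k + 2) = 1 ↔
      b + 1 = a ∨ (a = 0 ∧ b = k + 1)) := by
    intro a b ha hb
    by_cases hab : b ≤ a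
    · rw [show k + 2 - b + a = (a - b) + (k + 2) by omega, Nat.add_mod_right,
        Nat.mod_eq_of_lt (by omega)]
      omega
    · rw [Nat.mod_eq_of_lt (by omega)]
      omega
  rw [h _ _ hi hj, h _ _ hj hi]
  tauto

/-- In a graph without holes, two nonadjacent neighbours of `x` are not joined by a path that
avoids the closed neighbourhood of `x`. -/
theorem NoHole.adj_of_path {H : SimpleGraph V} {D : Finset V} (hD : NoHole H D) {x p q : V}
    (hx : x ∈ D) (hp : p ∈ D) (hq : q ∈ D) (hxp : H.Adj x p) (hxq : H.Adj x q) (hpq : p ≠ q)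
    (h : ∃ k, HasPathThrough H (fun z => z ∈ D ∧ z ≠ x ∧ ¬ H.Adj x z) p q k) : H.Adj p q := by
  by_contra hnpq
  obtain ⟨k, w, h0, hk, hadj, hC, hind⟩ := HasPathThrough.exists_induced h
  have hk2 : 2 ≤ k := by
    rcases k with _ | _ | k
    · exact absurd (h0.symm.trans hk) hpq
    · exact absurd (h0 ▸ hk ▸ hadj 0 (by omega)) hnpq
    · omega
  have hwD : ∀ i ≤ k, w i ∈ D := by
    intro i hi
    by_cases h1 : i = 0
    · rw [h1, h0]; exact hp
    · by_cases h2 : i = k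
      · rw [h2, hk]; exact hq
      · exact (hC i (by omega) (by omega)).1
  have hwx : ∀ i ≤ k, w i ≠ x := by
    intro i hi
    by_cases h1 : i = 0
    · rw [h1, h0]; exact hxp.ne'
    · by_cases h2 : i = k
      · rw [h2, hk]; exact hxq.ne'
      · exact (hC i (by omega) (by omega)).2.1
  have hxw : ∀ i ≤ k, H.Adj x (w i) ↔ i = 0 ∨ i = k := by
    intro i hi
    by_cases h1 : i = 0
    · rw [h1, h0]; simpa using hxp
    · by_cases h2 : i = k
      · rw [h2, hk]; simpa using hxq
      · have := (hC i (by omega) (by omega)).2.2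
        tauto
  have hww : ∀ i ≤ k, ∀ j ≤ k, H.Adj (w i) (w j) ↔ i + 1 = j ∨ j + 1 = i := by
    intro i hi j hj
    constructor
    · intro h
      rcases lt_trichotomy i j with hij | rfl | hij
      · exact Or.inl ((hind i j hij hj).2 h).symm
      · exact absurd h H.irrefl
      · exact Or.inr ((hind j i hij hi).2 h.symm).symm
    · rintro (rfl | rfl)
      · exact hadj i (by omega)
      · exact (hadj j (by omega)).symm
  -- The induced path occupies positions `0` to `k`, and `x` closes it at position `k + 1`. Since `k
  -- ≥ 2`, this is a hole.
  let f : Fin (k + 2) → V := fun i => if i.1 ≤ k then w i.1 else x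
  have hf1 : ∀ i : Fin (k + 2), i.1 ≤ k → f i = w i.1 := fun i hi => if_pos hi
  have hf2 : ∀ i : Fin (k + 2), ¬ i.1 ≤ k → f i = x := fun i hi => if_neg hi
  have hinj : Function.Injective f := by
    intro i j hij
    have hi := i.2
    have hj := j.2
    by_cases h1 : i.1 ≤ k <;> by_cases h2 : j.1 ≤ k
    · rw [hf1 i h1, hf1 j h2] at hij
      rcases lt_trichotomy i.1 j.1 with h | h | h
      · exact absurd hij (hind _ _ h h2).1
      · exact Fin.ext h
      · exact absurd hij.symm (hind _ _ h h1).1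
    · rw [hf1 i h1, hf2 j h2] at hij
      exact absurd hij (hwx _ h1)
    · rw [hf2 i h1, hf1 j h2] at hij
      exact absurd hij.symm (hwx _ h2)
    · exact Fin.ext (by omega)
  refine hD (k + 2) (by omega) ⟨⟨f, hinj⟩, ?_⟩ ?_
  · intro i j
    have hi := i.2
    have hj := j.2
    rw [cycleGraph_adj_iff]
    change H.Adj (f i) (f j) ↔ _
    by_cases h1 : i.1 ≤ k <;> by_cases h2 : j.1 ≤ k
    · rw [hf1 i h1, hf1 j h2, hww _ h1 _ h2]; omega
    · rw [hf1 i h1, hf2 j h2, H.adj_comm, hxw _ h1]; omega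
    · rw [hf2 i h1, hf1 j h2, hxw _ h2]; omega
    · rw [hf2 i h1, hf2 j h2]
      simp only [SimpleGraph.irrefl, false_iff]
      omega
  · intro i
    change f i ∈ D
    by_cases h1 : i.1 ≤ k
    · rw [hf1 i h1]; exact hwD _ h1
    · rw [hf2 i h1]; exact hx

variable [DecidableEq V]

/-- Dirac's theorem: every vertex that is not universal has a simplicial non-neighbour. -/
theorem NoHole.exists_simplicial {H : SimpleGraph V} {D : Finset V} (hD : NoHole H D) :
    ∀ x ∈ D, ∀ y ∈ D, y ≠ x → ¬ H.Adj x y →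
      ∃ v ∈ D, v ≠ x ∧ ¬ H.Adj x v ∧ SimplicialIn H D v := by
  classical
  induction hn : D.card using Nat.strong_induction_on generalizing D with
  | _ n ih =>
  intro x hx y hy hyx hxy
  set C' : V → Prop := fun z => z ∈ D ∧ z ≠ x ∧ ¬ H.Adj x z with hC'
  set r : V → V → Prop := fun a b => H.Adj a b ∧ C' a ∧ C' b with hr
  have hsymm : ∀ {a b}, Relation.ReflTransGen r a b → Relation.ReflTransGen r b a := by
    intro a b h
    induction h with
    | refl => exact .refl
    | tail _ h ih => exact .head ⟨h.1.symm, h.2.2, h.2.1⟩ ih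
  have hyC : C' y := ⟨hy, hyx, hxy⟩
  have hreach : ∀ z, Relation.ReflTransGen r y z → C' z := by
    intro z hz
    induction hz with
    | refl => exact hyC
    | tail _ h _ => exact h.2.2
  -- `C` is the component of `y` among the non-neighbours of `x`, and `S` below is its boundary in
  -- `D`. The boundary consists of neighbours of `x`.
  set C := D.filter fun z => Relation.ReflTransGen r y z with hC
  set S := D.filter fun p => p ∉ C ∧ ∃ c ∈ C, H.Adj p c with hS
  have hCmem : ∀ z ∈ C, C' z := fun z hz => hreach z (Finset.mem_filter.1 hz).2
  have hSx : ∀ p ∈ S, H.Adj x p := by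
    intro p hp
    obtain ⟨hpD, hpC, c, hc, hpc⟩ := Finset.mem_filter.1 hp
    by_contra hxp
    have hpx : p ≠ x := by rintro rfl; exact (hCmem c hc).2.2 hpc
    exact hpC (Finset.mem_filter.2 ⟨hpD, (Finset.mem_filter.1 hc).2.tail
      ⟨hpc.symm, hCmem c hc, hpD, hpx, hxp⟩⟩)
  have hSclique : ∀ p ∈ S, ∀ q ∈ S, p ≠ q → H.Adj p q := by
    intro p hp q hq hpq
    obtain ⟨hpD, hpC, c, hc, hpc⟩ := Finset.mem_filter.1 hp
    obtain ⟨hqD, hqC, c', hc', hqc⟩ := Finset.mem_filter.1 hq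
    -- Two boundary vertices are joined by a path through `C`, which avoids the closed neighbourhood
    -- of `x`.
    refine hD.adj_of_path hx hpD hqD (hSx p hp) (hSx q hq) hpq ?_
    obtain ⟨k, w, h0, hk, hadj, hw⟩ := exists_path_of_reflTransGen (H := H) (hCmem c hc)
      ((hsymm (Finset.mem_filter.1 hc).2).trans (Finset.mem_filter.1 hc').2)
    refine ⟨k + 2, fun i => if i = 0 then p else if i ≤ k + 1 then w (i - 1) else q, by simp,
      by simp, ?_, ?_⟩
    · intro i hi
      by_cases h1 : i = 0
      · subst h1; simpa [h0] using hpc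
      · by_cases h2 : i = k + 1
        · subst h2; simpa [hk] using hqc.symm
        · have := hadj (i - 1) (by omega)
          rw [show i - 1 + 1 = i by omega] at this
          simpa [h1, show i ≤ k + 1 by omega, show i ≤ k by omega] using this
    · intro i hi hik
      have := hw (i - 1) (by omega)
      simpa [show i ≠ 0 by omega, show i ≤ k + 1 by omega] using this
  -- The induction takes place in `E`, which omits `x`. A simplicial vertex of `E` lying in `C` is
  -- simplicial in `D`, so it remains to keep the vertex found out of `S`.
  set E := C ∪ S with hE
  have hED : E ⊆ D := Finset.union_subset (Finset.filter_subset _ _) (Finset.filter_subset _ _)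
  have hnbr : ∀ v ∈ C, ∀ z ∈ D, H.Adj v z → z ∈ E := by
    intro v hv z hz hvz
    by_cases hzC : z ∈ C
    · exact Finset.mem_union_left _ hzC
    · exact Finset.mem_union_right _ (Finset.mem_filter.2 ⟨hz, hzC, v, hv, hvz.symm⟩)
  have hyC' : y ∈ C := Finset.mem_filter.2 ⟨hy, .refl⟩
  have hfin : ∀ v ∈ C, SimplicialIn H E v →
      ∃ v ∈ D, v ≠ x ∧ ¬ H.Adj x v ∧ SimplicialIn H D v := by
    intro v hv hvE
    obtain ⟨h1, h2, h3⟩ := hCmem v hv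
    exact ⟨v, h1, h2, h3, fun a ha b hb hva hvb =>
      hvE a (hnbr v hv a ha hva) b (hnbr v hv b hb hvb) hva hvb⟩
  have hxE : x ∉ E := by
    rw [hE, Finset.mem_union, not_or]
    exact ⟨fun h => (hCmem x h).2.1 rfl, fun h => H.irrefl (hSx x h)⟩
  have hcard : E.card < n := by
    rw [← hn]
    exact Finset.card_lt_card ⟨hED, fun h => hxE (h hx)⟩
  have hIH := ih E.card hcard (hD.mono hED) rfl
  by_cases hcomp : ∀ a ∈ E, ∀ b ∈ E, a ≠ b → H.Adj a b
  · exact hfin y hyC' fun a ha b hb _ _ => hcomp a ha b hb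
  -- If every boundary vertex is universal in `E`, a vertex with a non-neighbour is not in `S`. If
  -- some `p ∈ S` is not universal, induction at `p` gives a non-neighbour of `p`, which is not in
  -- the clique `S`.
  by_cases huniv : ∀ p ∈ S, ∀ z ∈ E, z ≠ p → H.Adj p z
  · push Not at hcomp
    obtain ⟨a, ha, b, hb, hab, hnab⟩ := hcomp
    obtain ⟨v, hv, hva, hav, hvs⟩ := hIH a ha b hb hab.symm hnab
    refine hfin v ((Finset.mem_union.1 hv).resolve_right fun hvS => ?_) hvs
    exact hav (huniv v hvS a ha hva.symm).symm
  · push Not at huniv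
    obtain ⟨p, hp, z, hz, hzp, hnpz⟩ := huniv
    obtain ⟨v, hv, hvp, hpv, hvs⟩ := hIH p (Finset.mem_union_right _ hp) z hz hzp hnpz
    refine hfin v ((Finset.mem_union.1 hv).resolve_right fun hvS => ?_) hvs
    exact hpv (hSclique p hp v hvS hvp.symm)

theorem NoHole.perfectElim {H : SimpleGraph V} {D : Finset V} (hD : NoHole H D) :
    PerfectElim H D := by
  induction hn : D.card using Nat.strong_induction_on generalizing D with
  | _ n ih =>
  rcases D.eq_empty_or_nonempty with rfl | ⟨x, hx⟩
  · exact .nil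
  obtain ⟨v, hv, hvs⟩ : ∃ v ∈ D, SimplicialIn H D v := by
    by_cases h : ∀ y ∈ D, ∀ z ∈ D, y ≠ z → H.Adj y z
    · exact ⟨x, hx, fun a ha b hb _ _ => h a ha b hb⟩
    · push Not at h
      obtain ⟨y, hy, z, hz, hyz, hnyz⟩ := h
      obtain ⟨v, hv, _, _, hvs⟩ := hD.exists_simplicial y hy z hz hyz.symm hnyz
      exact ⟨v, hv, hvs⟩
  rw [← Finset.insert_erase hv]
  exact .cons _ _ (Finset.notMem_erase _ _)
    (ih _ (hn ▸ Finset.card_erase_lt_of_mem hv) (hD.mono (Finset.erase_subset _ _)) rfl)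
    (hvs.mono (Finset.erase_subset _ _))

theorem perfectElim_of_isChordalGraph {H : SimpleGraph V} {P : Set V}
    (hP : (H.induce P).IsChordalGraph) {D : Finset V} (hD : ∀ x ∈ D, x ∈ P) :
    PerfectElim H D := by
  refine NoHole.perfectElim fun n hn f hf => hP n hn ⟨⟨⟨fun i => ⟨f i, hD _ (hf i)⟩, ?_⟩, ?_⟩⟩
  · intro i j hij
    exact f.injective (congrArg Subtype.val hij)
  · intro i j
    exact f.map_rel_iff

end Chordal

/-! ### Connected triples; `(2K₂, C₄)`-free graphs and complements of grids -/

section ElementaryClasses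

variable {V : Type*}

theorem isolatedTriples_empty [DecidableEq V] (H : SimpleGraph V) :
    isolatedTriples H ∅ = ∅ := by
  refine Finset.eq_empty_of_forall_notMem fun S hS => ?_
  obtain ⟨⟨hS, hc⟩, _⟩ := mem_isolatedTriples.1 hS
  rw [Finset.subset_empty.1 hS] at hc
  simp at hc

theorem linQuot_isolatedTriples_of_forall [DecidableEq V] {H : SimpleGraph V}
    (h : ∀ W : Finset V, W.Nonempty → ∃ v ∈ W, AlmostSimplicial H W v) (W : Finset V) :
    LinQuot (isolatedTriples H W) := by
  induction W using Finset.strongInduction with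
  | H W ih =>
  rcases W.eq_empty_or_nonempty with rfl | hW
  · rw [isolatedTriples_empty]
    exact .nil
  · obtain ⟨v, hv, hgood⟩ := h W hW
    exact linQuot_isolatedTriples_of_erase hv hgood (ih _ (Finset.erase_ssubset hv))

theorem almostSimplicial_of_two {H : SimpleGraph V} {W : Finset V} {v : V} (p q : V)
    (h : ∀ a ∈ W, H.Adj v a → a = p ∨ a = q) : AlmostSimplicial H W v := by
  intro a ha b hb c hc hva hvb hvc hab hac _ _
  have h1 := h a ha hva
  have h2 := h b hb hvb
  have h3 := h c hc hvc
  rcases h1 with rfl | rfl <;> rcases h2 with rfl | rfl <;> rcases h3 with rfl | rfl <;> tauto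

/-- A connected graph on three vertices has a vertex adjacent to the other two, and this vertex is
isolated in the complement. -/
theorem isolatedTriples_compl_univ [DecidableEq V] [Fintype V] (G : SimpleGraph V) :
    isolatedTriples Gᶜ Finset.univ = connectedFamily G 3 := by
  ext S
  rw [mem_isolatedTriples, mem_connectedFamily]
  have hadj : ∀ p q, ¬ Gᶜ.Adj q p ↔ q = p ∨ G.Adj q p := by
    intro p q; rw [SimpleGraph.compl_adj]; tauto
  constructor
  · rintro ⟨⟨_, hc⟩, q, hq, hqp⟩
    refine ⟨hc, ?_⟩
    have hreach : ∀ p : (S : Set V), (G.induce (S : Set V)).Reachable ⟨q, hq⟩ p := by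
      rintro ⟨p, hp⟩
      rcases (hadj p q).1 (hqp p hp) with rfl | h
      · exact .refl _
      · exact SimpleGraph.Adj.reachable (G := G.induce (S : Set V)) h
    have : Nonempty (S : Set V) := ⟨⟨q, hq⟩⟩
    exact ⟨fun x y => (hreach x).symm.trans (hreach y)⟩
  · rintro ⟨hc, hconn⟩
    refine ⟨⟨Finset.subset_univ _, hc⟩, ?_⟩
    have hnt : Nontrivial (S : Set V) := by
      rw [Set.nontrivial_coe_sort]
      exact Finset.one_lt_card_iff_nontrivial.1 (by omega)
    have hnbr : ∀ x ∈ S, ∃ y ∈ S, G.Adj x y := by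
      intro x hx
      obtain ⟨y, hy⟩ := hconn.preconnected.exists_adj_of_nontrivial ⟨x, hx⟩
      exact ⟨y, y.2, hy⟩
    obtain ⟨a, ha⟩ : S.Nonempty := Finset.card_pos.1 (by omega)
    obtain ⟨b, hb, hab⟩ := hnbr a ha
    obtain ⟨c, hcS⟩ : ((S.erase a).erase b).Nonempty := by
      rw [← Finset.card_pos, Finset.card_erase_of_mem (Finset.mem_erase.2 ⟨hab.ne', hb⟩),
        Finset.card_erase_of_mem ha, hc]
      norm_num
    simp only [Finset.mem_erase] at hcS
    obtain ⟨hcb, hca, hcS⟩ := hcS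
    have hS : ({a, b, c} : Finset V) = S := by
      refine Finset.eq_of_subset_of_card_le ?_ ?_
      · intro x hx
        simp only [Finset.mem_insert, Finset.mem_singleton] at hx
        rcases hx with rfl | rfl | rfl <;> assumption
      · rw [hc, Finset.card_eq_three.2 ⟨a, b, c, hab.ne, Ne.symm hca, Ne.symm hcb, rfl⟩]
    obtain ⟨d, hd, hcd⟩ := hnbr c hcS
    have hmem : ∀ p ∈ S, p = a ∨ p = b ∨ p = c := by
      intro p hp; rw [← hS] at hp; simpa using hp
    rcases hmem d hd with rfl | rfl | rfl
    · refine ⟨d, ha, fun p hp => (hadj _ _).2 ?_⟩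
      rcases hmem p hp with rfl | rfl | rfl
      exacts [Or.inl rfl, Or.inr hab, Or.inr hcd.symm]
    · refine ⟨d, hb, fun p hp => (hadj _ _).2 ?_⟩
      rcases hmem p hp with rfl | rfl | rfl
      exacts [Or.inr hab.symm, Or.inl rfl, Or.inr hcd.symm]
    · exact absurd hcd G.irrefl

/-- The two diagonals of an induced four-cycle in the complement form an induced `2K_2` in `G`. -/
theorem SimpleGraph.IsTwoKTwoCFourFree.compl_no_fourCycle {G : SimpleGraph V}
    (hG : G.IsTwoKTwoCFourFree) {p q s t : V} (hpq : Gᶜ.Adj p q) (hqs : Gᶜ.Adj q s)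
    (hst : Gᶜ.Adj s t) (htp : Gᶜ.Adj t p) (hps : p ≠ s) (hps' : ¬ Gᶜ.Adj p s) (hqt : q ≠ t)
    (hqt' : ¬ Gᶜ.Adj q t) : False := by
  have h1 : G.Adj p s := by rw [SimpleGraph.compl_adj] at hps'; tauto
  have h2 : G.Adj q t := by rw [SimpleGraph.compl_adj] at hqt'; tauto
  rw [SimpleGraph.compl_adj] at hpq hqs hst htp
  refine hG.1 ⟨⟨⟨Sum.elim ![p, s] ![q, t], ?_⟩, ?_⟩⟩
  · rintro (i | i) (j | j) <;> fin_cases i <;> fin_cases j <;> simp <;> grind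
  · intro i j
    change G.Adj (Sum.elim ![p, s] ![q, t] i) (Sum.elim ![p, s] ![q, t] j) ↔ _
    rcases i with i | i <;> rcases j with j | j <;> fin_cases i <;> fin_cases j <;>
      simp [h1, h2, h1.symm, h2.symm, completeGraph] <;> grind [SimpleGraph.adj_comm]

theorem SimpleGraph.IsTwoKTwoCFourFree.compl_no_twoKTwo {G : SimpleGraph V}
    (hG : G.IsTwoKTwoCFourFree) {p q s t : V} (hpq : Gᶜ.Adj p q) (hst : Gᶜ.Adj s t)
    (h1 : p ≠ s) (h1' : ¬ Gᶜ.Adj p s) (h2 : p ≠ t) (h2' : ¬ Gᶜ.Adj p t)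
    (h3 : q ≠ s) (h3' : ¬ Gᶜ.Adj q s) (h4 : q ≠ t) (h4' : ¬ Gᶜ.Adj q t) : False := by
  have g1 : G.Adj p s := by rw [SimpleGraph.compl_adj] at h1'; tauto
  have g2 : G.Adj p t := by rw [SimpleGraph.compl_adj] at h2'; tauto
  have g3 : G.Adj q s := by rw [SimpleGraph.compl_adj] at h3'; tauto
  have g4 : G.Adj q t := by rw [SimpleGraph.compl_adj] at h4'; tauto
  rw [SimpleGraph.compl_adj] at hpq hst
  refine hG.2 ⟨⟨⟨![p, s, q, t], ?_⟩, ?_⟩⟩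
  · intro i j
    fin_cases i <;> fin_cases j <;> simp <;> grind
  · intro i j
    rw [cycleGraph_adj_iff]
    change G.Adj (![p, s, q, t] i) (![p, s, q, t] j) ↔ _
    fin_cases i <;> fin_cases j <;> simp <;> grind [SimpleGraph.adj_comm]

/-- A vertex `v` of least degree in `H[W]` can be deleted. If neighbours `a, b, c` of `v` violate
this, comparing degrees gives `a` two neighbours `d, d'`, and `b` one neighbour `f`, outside the
closed neighbourhood of `v`. The forbidden subgraphs force `f` to be adjacent to `d` and `d'`, and
then `d` to `d'`; now `dd'` and `vb` form an induced `2K_2`. -/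
theorem SimpleGraph.IsTwoKTwoCFourFree.linQuot [DecidableEq V] {G : SimpleGraph V}
    (hG : G.IsTwoKTwoCFourFree) (W : Finset V) : LinQuot (isolatedTriples Gᶜ W) := by
  classical
  refine linQuot_isolatedTriples_of_forall (fun W hW => ?_) W
  set H := Gᶜ with hH
  let N : V → Finset V := fun v => W.filter (H.Adj v)
  have hN : ∀ v x, x ∈ N v ↔ x ∈ W ∧ H.Adj v x := fun v x => Finset.mem_filter
  obtain ⟨v, hv, hmin⟩ := Finset.exists_min_image W (fun v => (N v).card) hW
  refine ⟨v, hv, fun a ha b hb c hc hva hvb hvc hab hac hnab hnac => ?_⟩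
  by_contra hbc
  have hcard : ∀ x ∈ W, (N v \ N x).card ≤ (N x \ N v).card := by
    intro x hx
    have h1 := Finset.card_sdiff_add_card_inter (N v) (N x)
    have h2 := Finset.card_sdiff_add_card_inter (N x) (N v)
    rw [Finset.inter_comm] at h2
    have := hmin x hx
    omega
  -- elements of `N(a) \ N[v]`
  have hpriv : ∀ x ∈ W, H.Adj v x → ∀ y, y ∈ (N x \ N v).erase v →
      y ∈ W ∧ y ≠ v ∧ H.Adj x y ∧ ¬ H.Adj v y := by
    intro x _ _ y hy
    rw [Finset.mem_erase, Finset.mem_sdiff, hN, hN] at hy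
    tauto
  -- As `N(v) \ N(a)` contains `a`, `b`, `c`, minimality makes `N(a) \ N(v)` have at least three
  -- elements, one of which is `v`.
  have ha2 : 1 < ((N a \ N v).erase v).card := by
    have h3 : ({a, b, c} : Finset V) ⊆ N v \ N a := by
      intro x hx
      simp only [Finset.mem_insert, Finset.mem_singleton] at hx
      rw [Finset.mem_sdiff, hN, hN]
      rcases hx with rfl | rfl | rfl
      · exact ⟨⟨ha, hva⟩, fun h => H.irrefl h.2⟩
      · exact ⟨⟨hb, hvb⟩, fun h => hnab h.2⟩
      · exact ⟨⟨hc, hvc⟩, fun h => hnac h.2⟩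
    have h4 := Finset.card_le_card h3
    rw [Finset.card_eq_three.2 ⟨a, b, c, hab, hac, hbc, rfl⟩] at h4
    have h5 := Finset.pred_card_le_card_erase (s := N a \ N v) (a := v)
    have := hcard a ha
    omega
  have hb1 : 0 < ((N b \ N v).erase v).card := by
    have h3 : ({a, b} : Finset V) ⊆ N v \ N b := by
      intro x hx
      simp only [Finset.mem_insert, Finset.mem_singleton] at hx
      rw [Finset.mem_sdiff, hN, hN]
      rcases hx with rfl | rfl
      · exact ⟨⟨ha, hva⟩, fun h => hnab h.2.symm⟩
      · exact ⟨⟨hb, hvb⟩, fun h => H.irrefl h.2⟩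
    have h4 := Finset.card_le_card h3
    rw [Finset.card_pair hab] at h4
    have h5 := Finset.pred_card_le_card_erase (s := N b \ N v) (a := v)
    have := hcard b hb
    omega
  obtain ⟨d, hd, d', hd', hdd⟩ := Finset.one_lt_card.1 ha2
  obtain ⟨f, hf⟩ := Finset.card_pos.1 hb1
  obtain ⟨_, hdv, had, hvd⟩ := hpriv a ha hva d hd
  obtain ⟨_, hdv', had', hvd'⟩ := hpriv a ha hva d' hd'
  obtain ⟨_, hfv, hbf, hvf⟩ := hpriv b hb hvb f hf
  have hnba : ¬ H.Adj b a := fun h => hnab h.symm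
  -- private neighbours of `a` and `b` are not shared
  have hbd : ∀ x, x ≠ v → H.Adj a x → ¬ H.Adj v x → ¬ H.Adj b x := by
    intro x hxv hax hvx hbx
    exact hG.compl_no_fourCycle hvb.symm hva hax hbx.symm (Ne.symm hab) hnba (Ne.symm hxv) hvx
  have haf : ¬ H.Adj a f := fun h => hbd f hfv h hvf hbf
  have hfd : ∀ x, x ≠ v → H.Adj a x → ¬ H.Adj v x → H.Adj f x := by
    intro x hxv hax hvx
    by_contra hfx
    refine hG.compl_no_twoKTwo hbf hax (Ne.symm hab) hnba ?_ (hbd x hxv hax hvx) ?_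
      (fun h => haf h.symm) ?_ hfx
    · rintro rfl; exact hnab hax
    · rintro rfl; exact hnba hbf
    · rintro rfl; exact hbd f hxv hax hvx hbf
  have hddadj : H.Adj d d' := by
    by_contra hnd
    refine hG.compl_no_fourCycle had (hfd d hdv had hvd).symm (hfd d' hdv' had' hvd') had'.symm
      ?_ haf hdd hnd
    rintro rfl; exact hnba hbf
  refine hG.compl_no_twoKTwo hddadj hvb hdv (fun h => hvd h.symm) ?_
    (fun h => hbd d hdv had hvd h.symm) hdv' (fun h => hvd' h.symm) ?_
    (fun h => hbd d' hdv' had' hvd' h.symm)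
  · rintro rfl; exact hvd hvb
  · rintro rfl; exact hvd' hvb

/-- A vertex of `W` with least coordinate sum has at most two neighbours in `W`, one in each
increasing direction. -/
theorem SimpleGraph.IsCoGrid.linQuot [DecidableEq V] {G : SimpleGraph V}
    (hG : G.IsCoGrid) (W : Finset V) : LinQuot (isolatedTriples Gᶜ W) := by
  obtain ⟨n, m, ⟨φ⟩⟩ := hG
  have hadj : ∀ x y, Gᶜ.Adj x y ↔
      ((SimpleGraph.pathGraph n).boxProd (SimpleGraph.pathGraph m)).Adj (φ x) (φ y) := by
    intro x y
    rw [SimpleGraph.compl_adj, ← φ.map_adj_iff, SimpleGraph.compl_adj, not_and, not_not,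
      ← φ.injective.ne_iff]
    constructor
    · rintro ⟨h1, h2⟩; exact h2 h1
    · intro h; exact ⟨h.ne, fun _ => h⟩
  refine linQuot_isolatedTriples_of_forall (fun W hW => ?_) W
  obtain ⟨v, hv, hmin⟩ := Finset.exists_min_image W
    (fun v => ((φ v).1 : ℕ) + ((φ v).2 : ℕ)) hW
  refine ⟨v, hv, ?_⟩
  have key : ∀ a ∈ W, Gᶜ.Adj v a →
      (((φ a).1 : ℕ) = (φ v).1 + 1 ∧ ((φ a).2 : ℕ) = (φ v).2) ∨
      (((φ a).1 : ℕ) = (φ v).1 ∧ ((φ a).2 : ℕ) = (φ v).2 + 1) := by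
    intro a ha hva
    have h := (hadj v a).1 hva
    rw [SimpleGraph.boxProd_adj, SimpleGraph.pathGraph_adj, SimpleGraph.pathGraph_adj,
      Fin.ext_iff, Fin.ext_iff] at h
    have := hmin a ha
    omega
  intro a ha b hb c hc hva hvb hvc hab hac _ _
  apply φ.injective
  have h1 := key a ha hva
  have h2 := key b hb hvb
  have h3 := key c hc hvc
  have h4 : ∀ x y, ((φ x).1 : ℕ) = (φ y).1 → ((φ x).2 : ℕ) = (φ y).2 → x = y := by
    intro x y h h'
    exact φ.injective (Prod.ext (Fin.ext h) (Fin.ext h'))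
  have h5 : ¬ (((φ a).1 : ℕ) = (φ b).1 ∧ ((φ a).2 : ℕ) = (φ b).2) := fun h => hab (h4 _ _ h.1 h.2)
  have h6 : ¬ (((φ a).1 : ℕ) = (φ c).1 ∧ ((φ a).2 : ℕ) = (φ c).2) := fun h => hac (h4 _ _ h.1 h.2)
  refine Prod.ext (Fin.ext ?_) (Fin.ext ?_) <;> omega

end ElementaryClasses

/-! ### Complements of chordal cacti -/

section ChordalCactus

/-- An end block: a nonempty vertex set `K`, attached at a single vertex `u`, no vertex of which
separates its own neighbours. -/
theorem exists_endBlock {X : Type*} [Finite X] (B : SimpleGraph X) (h : ∃ a b, B.Adj a b) :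
    ∃ (u : X) (K : Set X), K.Nonempty ∧ ∀ w ∈ K, w ≠ u ∧ (∃ p, B.Adj w p) ∧
      (∀ p, B.Adj w p → p ∈ K ∨ p = u) ∧
      ∀ p q, B.Adj w p → B.Adj w q → ∃ c : B.Walk p q, w ∉ c.support := by
  classical
  -- For an oriented edge `(u, w)` this is the set reachable from `w` without passing through `u`; a
  -- smallest such set is the end block.
  let K : X × X → Set X := fun t => {z | ∃ c : B.Walk t.2 z, t.1 ∉ c.support}
  obtain ⟨a, b, hab⟩ := h
  obtain ⟨⟨u, w⟩, huw, hmin⟩ := Set.exists_min_image {t : X × X | B.Adj t.1 t.2}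
    (fun t => (K t).ncard) (Set.toFinite _) ⟨(a, b), hab⟩
  have huw' : B.Adj u w := huw
  have hmem : ∀ z, z ∈ K (u, w) ↔ ∃ c : B.Walk w z, u ∉ c.support := fun z => Iff.rfl
  have hnbr : ∀ w' ∈ K (u, w), ∀ p, B.Adj w' p → p ∈ K (u, w) ∨ p = u := by
    intro w' hw' p hp
    obtain ⟨c, hc⟩ := (hmem _).1 hw'
    by_cases hpu : p = u
    · exact Or.inr hpu
    · refine Or.inl ((hmem _).2 ⟨c.concat hp, ?_⟩)
      rw [SimpleGraph.Walk.support_concat]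
      simpa [hc] using Ne.symm hpu
  have hne : ∀ w' ∈ K (u, w), w' ≠ u := by
    rintro w' hw' rfl
    obtain ⟨c, hc⟩ := (hmem _).1 hw'
    exact hc c.end_mem_support
  refine ⟨u, K (u, w), ⟨w, (hmem _).2 ⟨.nil, by simpa using huw'.ne⟩⟩, fun w' hw' =>
    ⟨hne w' hw', ?_, hnbr w' hw', ?_⟩⟩
  · obtain ⟨c, hc⟩ := (hmem _).1 hw'
    by_cases hww : w = w'
    · subst hww; exact ⟨u, huw'.symm⟩
    · exact ⟨_, (c.adj_penultimate (SimpleGraph.Walk.not_nil_of_ne hww)).symm⟩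
  · have hreach : ∀ p, B.Adj w' p → ∃ c : B.Walk p u, w' ∉ c.support := by
      intro p hp
      by_cases hpu : p = u
      · subst hpu
        exact ⟨.nil, by simpa using hne w' hw'⟩
      by_contra hcon
      push Not at hcon
      -- If `w'` separated `p` from `u`, the part beyond `w'` would be a strictly smaller candidate,
      -- as it omits `w'`.
      have hsub : K (w', p) ⊂ K (u, w) := by
        rw [Set.ssubset_iff_of_subset]
        · refine ⟨w', hw', ?_⟩
          rintro ⟨c, hc⟩
          exact hc c.end_mem_support
        · rintro z ⟨c, hc⟩
          have huc : u ∉ c.support := fun h =>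
            hc (c.support_takeUntil_subset_support h (hcon (c.takeUntil u h)))
          obtain ⟨c', hc'⟩ := (hmem _).1 ((hnbr w' hw' p hp).resolve_right hpu)
          refine (hmem _).2 ⟨c'.append c, ?_⟩
          rw [SimpleGraph.Walk.mem_support_append_iff, not_or]
          exact ⟨hc', huc⟩
      have h1 := Set.ncard_lt_ncard hsub (Set.toFinite _)
      have h2 := hmin (w', p) hp
      exact absurd h1 (not_lt.2 h2)
    intro p q hp hq
    obtain ⟨c, hc⟩ := hreach p hp
    obtain ⟨c', hc'⟩ := hreach q hq
    refine ⟨c.append c'.reverse, ?_⟩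
    rw [SimpleGraph.Walk.mem_support_append_iff, SimpleGraph.Walk.support_reverse,
      List.mem_reverse, not_or]
    exact ⟨hc, hc'⟩

/-- Every vertex of a cycle has degree two in it. -/
theorem SimpleGraph.Walk.IsCycle.not_three_edges {W : Type*} {T : SimpleGraph W} {u : W}
    {c : T.Walk u u} (hc : c.IsCycle) {a : W} {e f g : Sym2 W} (he : e ∈ c.edges)
    (hf : f ∈ c.edges) (hg : g ∈ c.edges) (hae : a ∈ e) (haf : a ∈ f) (hag : a ∈ g)
    (hef : e ≠ f) (heg : e ≠ g) (hfg : f ≠ g) : False := by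
  obtain ⟨x, rfl⟩ := hae
  obtain ⟨y, rfl⟩ := haf
  obtain ⟨z, rfl⟩ := hag
  have hmem : ∀ x, s(a, x) ∈ c.edges → x ∈ c.toSubgraph.neighborSet a := by
    intro x hx
    rw [SimpleGraph.Subgraph.mem_neighborSet, ← SimpleGraph.Subgraph.mem_edgeSet,
      SimpleGraph.Walk.mem_edges_toSubgraph]
    exact hx
  have h2 := hc.ncard_neighborSet_toSubgraph_eq_two (c.fst_mem_support_of_mem_edges he)
  have hfin : (c.toSubgraph.neighborSet a).Finite := Set.finite_of_ncard_ne_zero (by omega)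
  have hxy : x ≠ y := by rintro rfl; exact hef rfl
  have hxz : x ≠ z := by rintro rfl; exact heg rfl
  have hyz : y ≠ z := by rintro rfl; exact hfg rfl
  have h3 : ({x, y, z} : Set W).ncard ≤ (c.toSubgraph.neighborSet a).ncard := by
    refine Set.ncard_le_ncard ?_ hfin
    rintro w (rfl | rfl | rfl)
    exacts [hmem _ he, hmem _ hf, hmem _ hg]
  rw [Set.ncard_eq_three.2 ⟨x, y, z, hxy, hxz, hyz, rfl⟩] at h3
  omega

/-- An edge of a cycle meets at most two other edges of the cycle. -/
theorem SimpleGraph.Walk.IsCycle.not_three_adjacent_edges {W : Type*} {T : SimpleGraph W} {u : W}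
    {c : T.Walk u u} (hc : c.IsCycle) {e f g h : Sym2 W} (he : e ∈ c.edges)
    (hf : f ∈ c.edges) (hg : g ∈ c.edges) (hh : h ∈ c.edges)
    (hef : e ≠ f) (heg : e ≠ g) (heh : e ≠ h) (hfg : f ≠ g) (hfh : f ≠ h) (hgh : g ≠ h)
    (hf' : ∃ w, w ∈ e ∧ w ∈ f) (hg' : ∃ w, w ∈ e ∧ w ∈ g) (hh' : ∃ w, w ∈ e ∧ w ∈ h) :
    False := by
  induction e using Sym2.ind with
  | _ a b =>
  obtain ⟨x, hx, hxf⟩ := hf'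
  obtain ⟨y, hy, hyg⟩ := hg'
  obtain ⟨z, hz, hzh⟩ := hh'
  -- The edge has two endpoints, so two of the three other edges meet it at the same one.
  have key : x = y ∨ x = z ∨ y = z := by
    rw [Sym2.mem_iff] at hx hy hz
    rcases hx with rfl | rfl <;> rcases hy with rfl | rfl <;> rcases hz with rfl | rfl <;> tauto
  rcases key with rfl | rfl | rfl
  · exact hc.not_three_edges he hf hg hx hxf hyg hef heg hfg
  · exact hc.not_three_edges he hf hh hx hxf hzh hef heh hfh
  · exact hc.not_three_edges he hg hh hy hyg hzh heg heh hgh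

variable {V W : Type*} {H : SimpleGraph V} {T : SimpleGraph W} {P : T.edgeSet → Set V}

/-- `x` lies in the piece `e`, and this piece has at least two vertices in `A`. -/
def PieceInc (P : T.edgeSet → Set V) (A : Finset V) (e : T.edgeSet) (x : V) : Prop :=
  x ∈ A ∧ x ∈ P e ∧ ∃ y ∈ A, y ∈ P e ∧ y ≠ x

/-- `x` lies in two pieces. -/
def SharedVertex (P : T.edgeSet → Set V) (A : Finset V) (x : V) : Prop :=
  ∃ e f, e ≠ f ∧ PieceInc P A e x ∧ PieceInc P A f x

/-- The bipartite incidence graph of pieces and shared vertices. -/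
def incidenceGraph (P : T.edgeSet → Set V) (A : Finset V) : SimpleGraph (T.edgeSet ⊕ V) where
  Adj
    | .inl e, .inr x => PieceInc P A e x ∧ SharedVertex P A x
    | .inr x, .inl e => PieceInc P A e x ∧ SharedVertex P A x
    | _, _ => False
  symm := ⟨by rintro (e | x) (f | y) h <;> exact h⟩
  loopless := ⟨by rintro (e | x) h <;> exact h⟩

/-- The path alternates between gluing vertices and pieces. Prefixing `e` at `z` and closing through
`x`, which lies in both `g` and `e`, produces a ring of pieces, which lies on a cycle of the
skeleton. The piece `f` is the first one on the path. -/
theorem SimpleGraph.IsChordalCactusDecomposition.exists_cycle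
    (hP : H.IsChordalCactusDecomposition T P) {A : Finset V} {e g : T.edgeSet} {z x : V}
    (q : (incidenceGraph P A).Walk (.inr z) (.inl g)) (hq : q.IsPath)
    (he : Sum.inl e ∉ q.support) (hx : Sum.inr x ∉ q.support) (hze : z ∈ P e) (hxe : x ∈ P e)
    (hxg : x ∈ P g) :
    ∃ f, z ∈ P f ∧ f ≠ g ∧ f ≠ e ∧ g ≠ e ∧ ∃ (u : W) (c : T.Walk u u), c.IsCycle ∧
      (e : Sym2 W) ∈ c.edges ∧ (f : Sym2 W) ∈ c.edges ∧ (g : Sym2 W) ∈ c.edges := by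
  classical
  -- the vertices of the path alternate between vertices and pieces
  have halt : ∀ i, (2 * i ≤ q.length → ∃ y, q.getVert (2 * i) = .inr y) ∧
      (2 * i + 1 ≤ q.length → ∃ f, q.getVert (2 * i + 1) = .inl f) := by
    have hstep1 : ∀ i y, i + 1 ≤ q.length → q.getVert i = .inr y →
        ∃ f, q.getVert (i + 1) = .inl f := by
      intro i y hi h
      have := q.adj_getVert_succ (i := i) (by omega)
      rw [h] at this
      rcases h' : q.getVert (i + 1) with f | y'
      · exact ⟨f, rfl⟩
      · rw [h'] at this; exact this.elim
    have hstep2 : ∀ i f, i + 1 ≤ q.length → q.getVert i = .inl f →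
        ∃ y, q.getVert (i + 1) = .inr y := by
      intro i f hi h
      have := q.adj_getVert_succ (i := i) (by omega)
      rw [h] at this
      rcases h' : q.getVert (i + 1) with f' | y
      · rw [h'] at this; exact this.elim
      · exact ⟨y, rfl⟩
    intro i
    induction i with
    | zero => exact ⟨fun _ => ⟨z, by simp⟩, fun h => hstep1 0 z h (by simp)⟩
    | succ i ih =>
      have h1 : 2 * (i + 1) ≤ q.length → ∃ y, q.getVert (2 * (i + 1)) = .inr y := by
        intro h
        obtain ⟨f, hf⟩ := ih.2 (by omega)
        exact hstep2 (2 * i + 1) f (by omega) hf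
      refine ⟨h1, fun h => ?_⟩
      obtain ⟨y, hy⟩ := h1 (by omega)
      exact hstep1 _ y h hy
  obtain ⟨k, hk⟩ : ∃ k, q.length = 2 * k + 1 := by
    rcases Nat.even_or_odd' q.length with ⟨k, hk | hk⟩
    · obtain ⟨y, hy⟩ := (halt k).1 hk.ge
      rw [← hk, SimpleGraph.Walk.getVert_length] at hy
      exact absurd hy (by simp)
    · exact ⟨k, hk⟩
  have hY : ∀ i, ∃ y, i ≤ k → q.getVert (2 * i) = .inr y := by
    intro i
    by_cases hi : i ≤ k
    · obtain ⟨y, hy⟩ := (halt i).1 (by omega)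
      exact ⟨y, fun _ => hy⟩
    · exact ⟨z, fun h => absurd h hi⟩
  have hG : ∀ i, ∃ f, i ≤ k → q.getVert (2 * i + 1) = .inl f := by
    intro i
    by_cases hi : i ≤ k
    · obtain ⟨y, hy⟩ := (halt i).2 (by omega)
      exact ⟨y, fun _ => hy⟩
    · exact ⟨g, fun h => absurd h hi⟩
  choose Y hY using hY
  choose G hG using hG
  have hY0 : Y 0 = z := by have := hY 0 (by omega); simpa using this.symm
  have hGk : G k = g := by
    have := hG k le_rfl
    rw [← hk, SimpleGraph.Walk.getVert_length] at this
    exact (Sum.inl.inj this).symm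
  have hinj := hq.getVert_injOn
  have hYinj : ∀ i ≤ k, ∀ j ≤ k, Y i = Y j → i = j := by
    intro i hi j hj hij
    have := hinj (show 2 * i ≤ q.length by omega) (show 2 * j ≤ q.length by omega)
      (by rw [hY i hi, hY j hj, hij])
    omega
  have hGinj : ∀ i ≤ k, ∀ j ≤ k, G i = G j → i = j := by
    intro i hi j hj hij
    have := hinj (show 2 * i + 1 ≤ q.length by omega) (show 2 * j + 1 ≤ q.length by omega)
      (by rw [hG i hi, hG j hj, hij])
    omega
  have hGe : ∀ i ≤ k, G i ≠ e := by
    intro i hi h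
    exact he (h ▸ hG i hi ▸ q.getVert_mem_support _)
  have hYx : ∀ i ≤ k, Y i ≠ x := by
    intro i hi h
    exact hx (h ▸ hY i hi ▸ q.getVert_mem_support _)
  have hYG : ∀ i ≤ k, Y i ∈ P (G i) := by
    intro i hi
    have := q.adj_getVert_succ (i := 2 * i) (by omega)
    rw [hY i hi, hG i hi] at this
    exact this.1.2.1
  have hYG' : ∀ i < k, Y (i + 1) ∈ P (G i) := by
    intro i hi
    have := q.adj_getVert_succ (i := 2 * i + 1) (by omega)
    rw [show 2 * i + 1 + 1 = 2 * (i + 1) by ring, hY (i + 1) (by omega), hG i (by omega)] at this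
    exact this.1.2.1
  -- If the path had only one piece, `z` and `x` would be two common vertices of `e` and `g`. So the
  -- ring has at least three pieces.
  obtain ⟨m, rfl⟩ : ∃ m, k = m + 1 := by
    rcases k with _ | m
    · exfalso
      have h1 := hYG 0 le_rfl
      rw [hY0, hGk] at h1
      have h2 := hGe 0 le_rfl
      rw [hGk] at h2
      exact hYx 0 le_rfl (hY0.trans (hP.inter_subsingleton g e h2 ⟨h1, hze⟩ ⟨hxg, hxe⟩))
    · exact ⟨m, rfl⟩
  obtain ⟨u, c, hc, hmem⟩ := hP.ring_on_cycle m
    (fun i => if i.1 = 0 then e else G (i.1 - 1)) (fun i => if i.1 ≤ m + 1 then Y i.1 else x) (by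
      intro i j hij
      have hi := i.2
      have hj := j.2
      simp only at hij
      split_ifs at hij with h1 h2 h2
      · exact Fin.ext (by omega)
      · exact absurd hij.symm (hGe _ (by omega))
      · exact absurd hij (hGe _ (by omega))
      · have := hGinj _ (by omega) _ (by omega) hij
        exact Fin.ext (by omega)) (by
      intro i j hij
      have hi := i.2
      have hj := j.2
      simp only at hij
      split_ifs at hij with h1 h2 h2
      · exact Fin.ext (hYinj _ h1 _ h2 hij)
      · exact absurd hij (hYx _ h1)
      · exact absurd hij.symm (hYx _ h2)
      · exact Fin.ext (by omega)) (by
      intro i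
      have hi := i.2
      have hsucc : ((i + 1 : Fin (m + 3)) : ℕ) = if i.1 = m + 2 then 0 else i.1 + 1 := by
        rw [Fin.val_add_one]
        simp only [Fin.ext_iff, Fin.val_last]
      constructor
      · by_cases h0 : i.1 = 0
        · simpa [h0, hY0] using hze
        · by_cases h1 : i.1 ≤ m + 1
          · have := hYG' (i.1 - 1) (by omega)
            rw [show i.1 - 1 + 1 = i.1 by omega] at this
            simpa [h0, h1] using this
          · have h2 : i.1 - 1 = m + 1 := by omega
            simpa [h0, h1, h2, hGk] using hxg
      · by_cases h1 : i.1 ≤ m + 1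
        · have h2 : i.1 ≠ m + 2 := by omega
          simpa [hsucc, h1, h2] using hYG i.1 h1
        · have h2 : i.1 = m + 2 := by omega
          simpa [hsucc, h2] using hxe)
  refine ⟨G 0, hY0 ▸ hYG 0 (by omega), ?_, hGe 0 (by omega), hGk ▸ hGe _ le_rfl, u, c, hc, ?_, ?_, ?_⟩
  · intro h
    have := hGinj 0 (by omega) (m + 1) le_rfl (h.trans hGk.symm)
    omega
  · simpa using hmem ⟨0, by omega⟩
  · simpa using hmem ⟨1, by omega⟩
  · simpa [hGk] using hmem ⟨m + 2, by omega⟩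

/-- The two neighbours of a piece in a ring of pieces are determined by the piece. -/
theorem SimpleGraph.IsChordalCactusDecomposition.ring_neighbors
    (hP : H.IsChordalCactusDecomposition T P) {e f g f' g' : T.edgeSet}
    (hfg : f ≠ g) (hfe : f ≠ e) (hge : g ≠ e) (hge' : g' ≠ e)
    (hf : (P e ∩ P f).Nonempty) (hg : (P e ∩ P g).Nonempty) (hg' : (P e ∩ P g').Nonempty)
    (h : ∃ (u : W) (c : T.Walk u u), c.IsCycle ∧
      (e : Sym2 W) ∈ c.edges ∧ (f : Sym2 W) ∈ c.edges ∧ (g : Sym2 W) ∈ c.edges)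
    (h' : ∃ (u : W) (c : T.Walk u u), c.IsCycle ∧
      (e : Sym2 W) ∈ c.edges ∧ (f' : Sym2 W) ∈ c.edges ∧ (g' : Sym2 W) ∈ c.edges) :
    g' = f ∨ g' = g := by
  obtain ⟨u, c, hc, hec, hfc, hgc⟩ := h
  obtain ⟨u', c', hc', hec', _, hgc'⟩ := h'
  -- Both cycles of the skeleton pass through `e`, hence have the same edges by the cactus property.
  have hgc'' : (g' : Sym2 W) ∈ c.edges :=
    (hP.cactus c c' hc hc' ⟨e, hec, hec'⟩ g').2 hgc'
  by_contra hcon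
  push Not at hcon
  have hne : ∀ {a b : T.edgeSet}, a ≠ b → (a : Sym2 W) ≠ b := fun h h' => h (Subtype.ext h')
  exact hc.not_three_adjacent_edges hec hfc hgc hgc'' (hne hfe.symm) (hne hge.symm)
    (hne hge'.symm) (hne hfg) (hne hcon.1.symm) (hne hcon.2.symm)
    (hP.inter_common_endpoint e f hfe.symm hf) (hP.inter_common_endpoint e g hge.symm hg)
    (hP.inter_common_endpoint e g' hge'.symm hg')

/-- A piece that does not separate its shared vertices has at most two of them. -/
theorem SimpleGraph.IsChordalCactusDecomposition.piece_degree
    (hP : H.IsChordalCactusDecomposition T P) {A : Finset V} {e : T.edgeSet}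
    (hw : ∀ p q, (incidenceGraph P A).Adj (.inl e) p → (incidenceGraph P A).Adj (.inl e) q →
      ∃ c : (incidenceGraph P A).Walk p q, Sum.inl e ∉ c.support) {x y z : V}
    (hx : (incidenceGraph P A).Adj (.inl e) (.inr x))
    (hy : (incidenceGraph P A).Adj (.inl e) (.inr y))
    (hz : (incidenceGraph P A).Adj (.inl e) (.inr z))
    (hxy : x ≠ y) (hxz : x ≠ z) (hyz : y ≠ z) : False := by
  classical
  have hxe : x ∈ P e := hx.1.2.1
  have key : ∀ y, x ≠ y → (incidenceGraph P A).Adj (.inl e) (.inr y) → ∃ f g, y ∈ P g ∧ x ∈ P f ∧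
      f ≠ g ∧ f ≠ e ∧ g ≠ e ∧ ∃ (u : W) (c : T.Walk u u), c.IsCycle ∧
      (e : Sym2 W) ∈ c.edges ∧ (f : Sym2 W) ∈ c.edges ∧ (g : Sym2 W) ∈ c.edges := by
    intro y hxy hy
    obtain ⟨c, hc⟩ := hw _ _ hx hy
    have aux : ∀ (t : T.edgeSet ⊕ V) (d : (incidenceGraph P A).Walk (.inr x) t),
        (incidenceGraph P A).Adj t (.inr y) → d.IsPath → Sum.inr y ∉ d.support →
        Sum.inl e ∉ d.support → ∃ f g, y ∈ P g ∧ x ∈ P f ∧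
        f ≠ g ∧ f ≠ e ∧ g ≠ e ∧ ∃ (u : W) (c : T.Walk u u), c.IsCycle ∧
        (e : Sym2 W) ∈ c.edges ∧ (f : Sym2 W) ∈ c.edges ∧ (g : Sym2 W) ∈ c.edges := by
      rintro (g | t) d hadj hdp hyd hed
      · obtain ⟨f, h1, h2, h3, h4, h5⟩ := hP.exists_cycle d hdp hed hyd hxe hy.1.2.1 hadj.1.2.1
        exact ⟨f, g, hadj.1.2.1, h1, h2, h3, h4, h5⟩
      · exact hadj.elim
    have hpath : c.bypass.IsPath := c.bypass_isPath
    have hep : Sum.inl e ∉ c.bypass.support := fun h => hc (c.support_bypass_subset_support h)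
    generalize c.bypass = p at hpath hep
    have hadj := p.adj_penultimate (SimpleGraph.Walk.not_nil_of_ne (by simpa using hxy))
    have hsupp : p.support = p.dropLast.support ++ [.inr y] := by
      conv_lhs => rw [← p.concat_dropLast hadj]
      rw [SimpleGraph.Walk.support_concat]
    have hnd := hpath.support_nodup
    rw [hsupp, List.nodup_append] at hnd
    rw [hsupp] at hep
    exact aux _ p.dropLast hadj hpath.dropLast (fun h => hnd.2.2 _ h _ (by simp) rfl)
      fun h => hep (List.mem_append_left _ h)
  obtain ⟨f, g, hyg, hxf, hfg, hfe, hge, hcyc⟩ := key y hxy hy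
  obtain ⟨f', g', hzg', hxf', hfg', hfe', hge', hcyc'⟩ := key z hxz hz
  have hye : y ∈ P e := hy.1.2.1
  have hze : z ∈ P e := hz.1.2.1
  -- The piece `g'` at `z` is one of the two ring neighbours of `e`, so it shares with `e` both `z`
  -- and one of `x`, `y`.
  rcases hP.ring_neighbors hfg hfe hge hge' ⟨x, hxe, hxf⟩ ⟨y, hye, hyg⟩ ⟨z, hze, hzg'⟩ hcyc hcyc'
    with rfl | rfl
  · exact hxz (hP.inter_subsingleton _ _ hge' ⟨hxf, hxe⟩ ⟨hzg', hze⟩)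
  · exact hyz (hP.inter_subsingleton _ _ hge' ⟨hyg, hye⟩ ⟨hzg', hze⟩)

/-- A shared vertex that does not separate its pieces lies in at most two of them. -/
theorem SimpleGraph.IsChordalCactusDecomposition.vertex_degree
    (hP : H.IsChordalCactusDecomposition T P) {A : Finset V} {x : V}
    (hw : ∀ p q, (incidenceGraph P A).Adj (.inr x) p → (incidenceGraph P A).Adj (.inr x) q →
      ∃ c : (incidenceGraph P A).Walk p q, Sum.inr x ∉ c.support) {e f g : T.edgeSet}
    (he : (incidenceGraph P A).Adj (.inr x) (.inl e))
    (hf : (incidenceGraph P A).Adj (.inr x) (.inl f))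
    (hg : (incidenceGraph P A).Adj (.inr x) (.inl g))
    (hef : e ≠ f) (heg : e ≠ g) (hfg : f ≠ g) : False := by
  classical
  have hxe : x ∈ P e := he.1.2.1
  have key : ∀ g, e ≠ g → (incidenceGraph P A).Adj (.inr x) (.inl g) → ∃ z f, z ≠ x ∧ z ∈ P e ∧
      z ∈ P f ∧ f ≠ g ∧ f ≠ e ∧ g ≠ e ∧ ∃ (u : W) (c : T.Walk u u), c.IsCycle ∧
      (e : Sym2 W) ∈ c.edges ∧ (f : Sym2 W) ∈ c.edges ∧ (g : Sym2 W) ∈ c.edges := by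
    intro g heg hg
    obtain ⟨c, hc⟩ := hw _ _ he hg
    have hpath : c.bypass.IsPath := c.bypass_isPath
    have hxp : Sum.inr x ∉ c.bypass.support := fun h => hc (c.support_bypass_subset_support h)
    generalize c.bypass = p at hpath hxp
    cases p with
    | nil => exact absurd rfl heg
    | @cons _ t _ hadj p =>
      rw [SimpleGraph.Walk.cons_isPath_iff] at hpath
      rw [SimpleGraph.Walk.support_cons, List.mem_cons, not_or] at hxp
      rcases t with f | z
      · exact hadj.elim
      · have hze : z ∈ P e := hadj.1.2.1
        obtain ⟨f, h1, h2, h3, h4, h5⟩ := hP.exists_cycle p hpath.1 hpath.2 hxp.2 hze hxe hg.1.2.1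
        refine ⟨z, f, ?_, hze, h1, h2, h3, h4, h5⟩
        rintro rfl
        exact hxp.2 p.start_mem_support
  obtain ⟨z, f₁, hzx, hze, hzf, hff, hfe, hfe', hcyc⟩ := key f hef hf
  obtain ⟨z', f₂, hzx', hze', hzf', hff', hge, hge', hcyc'⟩ := key g heg hg
  have hxf : x ∈ P f := hf.1.2.1
  have hxg : x ∈ P g := hg.1.2.1
  -- Of the ring neighbours of `e`, one is `f` and the other, `f₁`, meets `e` at `z`. So `g` is `f`,
  -- or else it shares both `x` and `z` with `e`.
  rcases hP.ring_neighbors hff hfe hfe' hge' ⟨z, hze, hzf⟩ ⟨x, hxe, hxf⟩ ⟨x, hxe, hxg⟩ hcyc hcyc'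
    with rfl | rfl
  · exact hzx (hP.inter_subsingleton _ _ hge' ⟨hzf, hze⟩ ⟨hxg, hxe⟩)
  · exact hfg rfl

end ChordalCactus

/-! ### Linear quotients for complements of chordal cacti. -/

section ChordalCactusLinQuot

theorem SimpleGraph.IsCycleOfLengthGeThree.neighbors_of_mem {V : Type*} {H : SimpleGraph V}
    {S : Set V} (h : (H.induce S).IsCycleOfLengthGeThree) {x : V} (hx : x ∈ S) :
    ∃ p q, ∀ y ∈ S, H.Adj x y → y = p ∨ y = q := by
  obtain ⟨n, hn, ⟨φ⟩⟩ := h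
  obtain ⟨k, rfl⟩ : ∃ k, n = k + 2 := ⟨n - 2, by omega⟩
  set i := φ ⟨x, hx⟩ with hi
  have hik := i.2
  refine ⟨φ.symm ⟨if i.1 = 0 then k + 1 else i.1 - 1, by split_ifs <;> omega⟩,
    φ.symm ⟨if i.1 = k + 1 then 0 else i.1 + 1, by split_ifs <;> omega⟩, fun y hy hxy => ?_⟩
  have hadj : (SimpleGraph.cycleGraph (k + 2)).Adj i (φ ⟨y, hy⟩) := φ.map_adj_iff.2 hxy
  rw [cycleGraph_adj_iff] at hadj
  have hjk := (φ ⟨y, hy⟩).2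
  have hback : ∀ j, φ ⟨y, hy⟩ = j → y = φ.symm j := by
    rintro j rfl
    simp
  have hor : φ ⟨y, hy⟩ = ⟨if i.1 = 0 then k + 1 else i.1 - 1, by split_ifs <;> omega⟩ ∨
      φ ⟨y, hy⟩ = ⟨if i.1 = k + 1 then 0 else i.1 + 1, by split_ifs <;> omega⟩ := by
    simp only [Fin.ext_iff]
    split_ifs <;> omega
  exact hor.imp (hback _) (hback _)

variable {V W : Type*} {H : SimpleGraph V} {T : SimpleGraph W} {P : T.edgeSet → Set V}
  {A : Finset V}

theorem PieceInc.of_mem {e : T.edgeSet} {x v : V} (h : PieceInc P A e x) (hv : v ∈ A)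
    (hve : v ∈ P e) : PieceInc P A e v := by
  obtain ⟨hx, hxe, y, hy, hye, hyx⟩ := h
  by_cases hvx : v = x
  · subst hvx
    exact ⟨hv, hve, y, hy, hye, hyx⟩
  · exact ⟨hv, hve, x, hx, hxe, Ne.symm hvx⟩

namespace SimpleGraph.IsChordalCactusDecomposition

theorem mem_of_adj (hP : H.IsChordalCactusDecomposition T P) {e : T.edgeSet} {x y : V}
    (hx : PieceInc P A e x) (hs : ¬ SharedVertex P A x) (hy : y ∈ A) (hxy : H.Adj x y) :
    y ∈ P e := by
  obtain ⟨f, hxf, hyf⟩ := hP.cover_edges x y hxy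
  by_contra hye
  refine hs ⟨e, f, ?_, hx, hx.1, hxf, y, hy, hyf, hxy.ne'⟩
  rintro rfl
  exact hye hyf

theorem almostSimplicial_of_isCycle (hP : H.IsChordalCactusDecomposition T P) {e : T.edgeSet}
    (hc : (H.induce (P e)).IsCycleOfLengthGeThree) {x : V} (hx : PieceInc P A e x)
    (hs : ¬ SharedVertex P A x) : AlmostSimplicial H A x := by
  obtain ⟨p, q, h⟩ := hc.neighbors_of_mem hx.2.1
  exact almostSimplicial_of_two p q fun a ha hxa => h a (hP.mem_of_adj hx hs ha hxa) hxa

variable [DecidableEq V]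

/-- The neighbours of an unshared vertex lie in its piece. Hence, when nothing can be deleted,
simplicial vertices of a chordal piece and all vertices of a cycle piece are shared, and one of them
differs from `z`. -/
theorem exists_shared_ne (hP : H.IsChordalCactusDecomposition T P)
    (hA : ∀ v ∈ A, ¬ AlmostSimplicial H A v) {e : T.edgeSet} {x : V} (hx : PieceInc P A e x)
    (z : V) : ∃ a, a ≠ z ∧ PieceInc P A e a ∧ SharedVertex P A a := by
  classical
  have hne : ∃ y ∈ A.filter (· ∈ P e), y ≠ z := by
    by_cases hxz : x = z
    · obtain ⟨_, _, y, hy, hye, hyx⟩ := hx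
      exact ⟨y, Finset.mem_filter.2 ⟨hy, hye⟩, hxz ▸ hyx⟩
    · exact ⟨x, Finset.mem_filter.2 ⟨hx.1, hx.2.1⟩, hxz⟩
  rcases hP.chordal_or_cycle e with hc | hc
  · obtain ⟨v, hv, hvz, hsimp⟩ := (perfectElim_of_isChordalGraph hc
      (D := A.filter (· ∈ P e)) fun x hx => (Finset.mem_filter.1 hx).2).exists_simplicial_ne z hne
    obtain ⟨hvA, hve⟩ := Finset.mem_filter.1 hv
    have hv' := hx.of_mem hvA hve
    refine ⟨v, hvz, hv', ?_⟩
    by_contra hs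
    have hmem : ∀ a ∈ A, H.Adj v a → a ∈ A.filter (· ∈ P e) := fun a ha hva =>
      Finset.mem_filter.2 ⟨ha, hP.mem_of_adj hv' hs ha hva⟩
    exact hA v hvA fun a ha b hb c hc hva hvb _ hab _ hnab _ =>
      absurd (hsimp a (hmem a ha hva) b (hmem b hb hvb) hva hvb hab) hnab
  · obtain ⟨y, hy, hyz⟩ := hne
    obtain ⟨hyA, hye⟩ := Finset.mem_filter.1 hy
    have hy' := hx.of_mem hyA hye
    refine ⟨y, hyz, hy', ?_⟩
    by_contra hs
    exact hA y hyA (hP.almostSimplicial_of_isCycle hc hy' hs)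

/-- A piece with exactly two shared vertices can be reduced to these two vertices. -/
theorem linQuot_of_two_shared (hP : H.IsChordalCactusDecomposition T P)
    (hA : ∀ v ∈ A, ¬ AlmostSimplicial H A v)
    (ih : ∀ B ⊂ A, LinQuot (isolatedTriples H B)) {e : T.edgeSet} {s x p : V}
    (hs : PieceInc P A e s) (hx : PieceInc P A e x) (hsx : s ≠ x)
    (h : ∀ y, PieceInc P A e y → SharedVertex P A y → y = s ∨ y = x)
    (hp : PieceInc P A e p) (hps : p ≠ s) (hpx : p ≠ x) : LinQuot (isolatedTriples H A) := by
  classical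
  have hpriv : ∀ y, PieceInc P A e y → y ≠ s → y ≠ x → ¬ SharedVertex P A y :=
    fun y hy h1 h2 h3 => (h y hy h3).elim h1 h2
  rcases hP.chordal_or_cycle e with hc | hc
  · have hD : ∀ y, y ∈ A.filter (· ∈ P e) ↔ y ∈ A ∧ y ∈ P e := fun y => Finset.mem_filter
    refine linQuot_isolatedTriples_of_attached (D := A.filter (· ∈ P e)) (Finset.filter_subset _ _)
      ((hD s).2 ⟨hs.1, hs.2.1⟩) ((hD x).2 ⟨hx.1, hx.2.1⟩) hsx ?_
      (perfectElim_of_isChordalGraph hc fun y hy => ((hD y).1 hy).2) (ih _ ?_)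
    · intro y hy hys hyx q hq hyq
      obtain ⟨hyA, hye⟩ := (hD y).1 hy
      have hy' := hs.of_mem hyA hye
      exact (hD q).2 ⟨hq, hP.mem_of_adj hy' (hpriv y hy' hys hyx) hq hyq⟩
    · rw [Finset.ssubset_iff_of_subset Finset.sdiff_subset]
      refine ⟨p, hp.1, fun hmem => (Finset.mem_sdiff.1 hmem).2 ?_⟩
      rw [Finset.mem_sdiff, hD]
      exact ⟨⟨hp.1, hp.2.1⟩, by simp [hps, hpx]⟩
  · exact absurd (hP.almostSimplicial_of_isCycle hc hp (hpriv p hp hps hpx)) (hA p hp.1)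

/-- In an end block of the incidence graph there are two pieces that share a vertex of the
block. -/
theorem exists_adjacent_pieces (hP : H.IsChordalCactusDecomposition T P)
    (hA : ∀ v ∈ A, ¬ AlmostSimplicial H A v) {u : T.edgeSet ⊕ V} {K : Set (T.edgeSet ⊕ V)}
    (hK : K.Nonempty) (hinc : ∀ w ∈ K, ∃ p, (incidenceGraph P A).Adj w p)
    (hnbr : ∀ w ∈ K, ∀ p, (incidenceGraph P A).Adj w p → p ∈ K ∨ p = u) :
    ∃ (x : V) (e f : T.edgeSet), e ≠ f ∧ .inr x ∈ K ∧ .inl e ∈ K ∧ .inl f ∈ K ∧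
      SharedVertex P A x ∧ PieceInc P A e x ∧ PieceInc P A f x := by
  have hx0 : ∃ x, Sum.inr x ∈ K ∧ SharedVertex P A x := by
    obtain ⟨w, hw⟩ := hK
    obtain ⟨p, hp⟩ := hinc w hw
    rcases w with e | x
    · rcases p with f | x
      · exact hp.elim
      · have hz : ∃ z : V, ∀ a, a ≠ z → (Sum.inr a : T.edgeSet ⊕ V) ≠ u := by
          rcases u with g | z
          · exact ⟨x, fun a _ => by simp⟩
          · exact ⟨z, fun a ha => by simpa using ha⟩
        obtain ⟨z, hz⟩ := hz
        obtain ⟨a, haz, hae, has⟩ := hP.exists_shared_ne hA hp.1 z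
        exact ⟨a, (hnbr _ hw (.inr a) ⟨hae, has⟩).resolve_right (hz a haz), has⟩
    · rcases p with f | y
      · exact ⟨x, hw, hp.2⟩
      · exact hp.elim
  -- If the attaching vertex of the block is the piece `e` itself, one moves along `f` to another
  -- shared vertex `y` and takes a second piece `g` there.
  have hstep : ∀ (x : V) (e f : T.edgeSet), e ≠ f → Sum.inr x ∈ K → SharedVertex P A x →
      PieceInc P A e x → PieceInc P A f x → u = .inl e → ∃ (x : V) (e f : T.edgeSet), e ≠ f ∧
      .inr x ∈ K ∧ .inl e ∈ K ∧ .inl f ∈ K ∧ SharedVertex P A x ∧ PieceInc P A e x ∧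
      PieceInc P A f x := by
    intro x e f hef hxK hxs hxe hxf hu
    have hfK : Sum.inl f ∈ K := (hnbr _ hxK (.inl f) ⟨hxf, hxs⟩).resolve_right (by
      rw [hu]; simpa using hef.symm)
    obtain ⟨y, hyx, hyf, hys⟩ := hP.exists_shared_ne hA hxf x
    have hyK : Sum.inr y ∈ K := (hnbr _ hfK (.inr y) ⟨hyf, hys⟩).resolve_right (by
      rw [hu]; simp)
    obtain ⟨g, hgf, hyg⟩ : ∃ g, g ≠ f ∧ PieceInc P A g y := by
      obtain ⟨g, g', hgg, hg, hg'⟩ := hys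
      by_cases hgf : g = f
      · exact ⟨g', fun h => hgg (hgf.trans h.symm), hg'⟩
      · exact ⟨g, hgf, hg⟩
    -- Otherwise `e` and `f` would share both `x` and `y`.
    have hge : g ≠ e := by
      rintro rfl
      exact hyx (hP.inter_subsingleton _ _ hgf ⟨hyg.2.1, hyf.2.1⟩ ⟨hxe.2.1, hxf.2.1⟩)
    have hgK : Sum.inl g ∈ K := (hnbr _ hyK (.inl g) ⟨hyg, hys⟩).resolve_right (by
      rw [hu]; simpa using hge)
    exact ⟨y, g, f, hgf, hyK, hgK, hfK, hys, hyg, hyf⟩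
  obtain ⟨x, hxK, hxs⟩ := hx0
  obtain ⟨e, f, hef, hxe, hxf⟩ := id hxs
  by_cases he : u = .inl e
  · exact hstep x e f hef hxK hxs hxe hxf he
  by_cases hf : u = .inl f
  · exact hstep x f e hef.symm hxK hxs hxf hxe hf
  · exact ⟨x, e, f, hef, hxK, (hnbr _ hxK (.inl e) ⟨hxe, hxs⟩).resolve_right (Ne.symm he),
      (hnbr _ hxK (.inl f) ⟨hxf, hxs⟩).resolve_right (Ne.symm hf), hxs, hxe, hxf⟩

/-- By induction on `A`, one may assume that no vertex can be deleted and no piece can be shrunk. In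
an end block, two pieces meeting at a shared vertex `x` then have only one further vertex of `A`
each, and `x` lies in no third piece with a neighbour of `x`. So `x` has at most two neighbours, a
contradiction. -/
theorem linQuot [Finite V] [Finite W] (hP : H.IsChordalCactusDecomposition T P) (A : Finset V) :
    LinQuot (isolatedTriples H A) := by
  classical
  induction A using Finset.strongInduction with
  | H A ih =>
  by_cases hA : ∃ v ∈ A, AlmostSimplicial H A v
  · obtain ⟨v, hv, hgood⟩ := hA
    exact linQuot_isolatedTriples_of_erase hv hgood (ih _ (Finset.erase_ssubset hv))
  push Not at hA
  rcases A.eq_empty_or_nonempty with rfl | ⟨v, hv⟩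
  · rw [isolatedTriples_empty]
    exact LinQuot.nil
  by_contra hcon
  have hpiece : ∃ e x, PieceInc P A e x := by
    by_contra hno
    push Not at hno
    refine hA v hv (almostSimplicial_of_two v v fun a ha hva => ?_)
    obtain ⟨e, hve, hae⟩ := hP.cover_edges v a hva
    exact (hno e v ⟨hv, hve, a, ha, hae, hva.ne'⟩).elim
  obtain ⟨e₀, x₀, hx₀⟩ := hpiece
  obtain ⟨a, -, hae, has⟩ := hP.exists_shared_ne hA hx₀ x₀
  obtain ⟨u, K, hK, hblock⟩ := exists_endBlock (incidenceGraph P A)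
    ⟨.inl e₀, .inr a, hae, has⟩
  obtain ⟨x, e, f, hef, hxK, heK, hfK, hxs, hxe, hxf⟩ := hP.exists_adjacent_pieces hA hK
    (fun w hw => (hblock w hw).2.1) fun w hw => (hblock w hw).2.2.1
  have hedge : ∀ e, Sum.inl e ∈ K → PieceInc P A e x →
      ∃ s, ∀ y ∈ A, y ∈ P e → y ≠ x → y = s := by
    intro e heK hxe
    obtain ⟨s, hsx, hse, hss⟩ := hP.exists_shared_ne hA hxe x
    have htwo : ∀ y, PieceInc P A e y → SharedVertex P A y → y = s ∨ y = x := by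
      intro y hye hys
      by_contra hy
      push Not at hy
      exact hP.piece_degree (hblock _ heK).2.2.2 ⟨hye, hys⟩ ⟨hse, hss⟩ ⟨hxe, hxs⟩ hy.1 hy.2 hsx
    refine ⟨s, fun y hy hye hyx => ?_⟩
    by_contra hys
    -- `s` and `x` are the only shared vertices of the piece, so a third vertex would allow it to be
    -- shrunk.
    exact hcon (hP.linQuot_of_two_shared hA ih hse hxe hsx htwo (hxe.of_mem hy hye) hys hyx)
  obtain ⟨s, hs⟩ := hedge e heK hxe
  obtain ⟨t, ht⟩ := hedge f hfK hxf
  refine hA x hxe.1 (almostSimplicial_of_two s t fun y hy hxy => ?_)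
  obtain ⟨g, hxg, hyg⟩ := hP.cover_edges x y hxy
  by_cases hge : g = e
  · exact Or.inl (hs y hy (hge ▸ hyg) hxy.ne')
  by_cases hgf : g = f
  · exact Or.inr (ht y hy (hgf ▸ hyg) hxy.ne')
  exact (hP.vertex_degree (hblock _ hxK).2.2.2 (e := e) (f := f) (g := g) ⟨hxe, hxs⟩ ⟨hxf, hxs⟩
    ⟨⟨hxe.1, hxg, y, hy, hyg, hxy.ne'⟩, hxs⟩ hef (Ne.symm hge) (Ne.symm hgf)).elim

end SimpleGraph.IsChordalCactusDecomposition

end ChordalCactusLinQuot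

/-! ### The main theorem. -/

theorem mainTheorem1 (K : Type*) [Field K] {V : Type*} [Fintype V] (G : SimpleGraph V)
    (hG : G.IsCoChordalCactus ∨ G.IsTwoKTwoCFourFree ∨ G.IsCoGrid) (r : ℕ) (hr : 2 ≤ r) :
    HasLinearResolution (connectedIdeal K G r) (r + 1) ∧
      (connectedIdeal K G r ≠ ⊥ → HasRegularity (connectedIdeal K G r) ((r : ℤ) + 1)) := by
  classical
  have hlin : LinQuot (connectedFamily G 3) := by
    rw [← isolatedTriples_compl_univ]
    rcases hG with ⟨n, T, P, hP⟩ | hG | hG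
    exacts [hP.linQuot _, hG.linQuot _, hG.linQuot _]
  have hres : LinearlyResolved Unit (connectedIdeal K G r).toUnit (r + 1) := by
    rw [connectedIdeal_eq_familyIdeal]
    exact (hlin.connectedFamily_of_three (r + 1) (by omega)).linearlyResolved fun S hS =>
      (mem_connectedFamily.1 hS).1
  refine ⟨hasLinearResolution_of_linearlyResolved hres, fun hI => ?_⟩
  have := hasRegularity_of_linearlyResolved hres hI
  push_cast at this
  exact this
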